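/- Let $(p_i)_{i\ge0}$, $(q_i)_{i\ge0}$ be real sequences with $p_i+q_i=1$ and $p_i>0$ for $i\ge0$, $q_i>0$ for $i\ge1$ and $q_0\ge0$, and let $\pi=(\pi_i)_{i\ge0}$ be a probability distribution on $\mathbb N=\{0,1,2,\dots\}$. Let $(Y_n)_{n\ge0}$ be a Markov chain on $\{-1,0,1,2,\dots\}$ with initial distribution $\pi$ that moves from $i\ge0$ to $i+1$ with probability $p_i$ and to $i-1$ with probability $q_i$, and for which $-1$ is absorbing. Let $m_{-1}=m_0=1$, let $(m_n)_{n\ge1}$ be an enumeration of the primes (each prime occurring exactly once), and let $$M(\Pi,\pi)=M_{m_{Y_0}}\otimes M_{m_{Y_1}}\otimes M_{m_{Y_2}}\otimes\cdots$$ be the resulting random infinite C*-tensor product of matrix algebras. Let $\mathcal Q=\bigotimes_{n\ge1}M_n$ be the universal UHF algebra. The multiplicity of a prime $r$ in the supernatural number of a unital C*-algebra $A$ is the supremum of all $k$ such that $M_{r^k}$ embeds unitally in $A$; a UHF algebra is of finite type if every prime has finite multiplicity in its supernatural number. Put $c_n=\prod_{j=0}^{n}\frac{q_j}{p_j}$ for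 $n\ge0$. **(1)** If $q_0=0$, then with probability $1$: (a) $M(\Pi,\pi)\cong\mathcal Q$ if $\sum_{n=1}^\infty\prod_{i=1}^n\frac{q_i}{p_i}=\infty$, in particular if there are $p\le q$ with $p_i=p$ and $q_i=q$ for all $i\ge1$; (b) $M(\Pi,\pi)$ is of finite type if $\sum_{n=1}^\infty\prod_{i=1}^n\frac{q_i}{p_i}<\infty$, in particular if there are $p>q$ with $p_i=p$ and $q_i=q$ for all $i\ge1$. **(2)** If $q_0>0$, then: (a) the set where $M(\Pi,\pi)$ is finite dimensional is an event. Its probability is $1$ if $\sum_{n=0}^\infty c_n=\infty$, in particular if there are $p\le q$ with $p_i=p$ and $q_i=q$ for all $i\ge1$, and otherwise is $$\left(\sum_{i=0}^\infty\pi_i\sum_{n=i}^\infty c_n\right)\bigg/\left(1+\sum_{n=0}^\infty c_n\right),$$ which simplifies to $\sum_{i=0}^\infty\pi_i\left(\frac qp\right)^{i+1}$ if $p_i=p>q=q_i$ for all $i\ge0$ (all the series in these two formulas converge); (b) for every integer $k\ge0$, the set where $M(\Pi,\pi)$ is isomorphic to $M_N$ for some $N$ all of whose prime factors belong to $\{m_1,\dots,m_k\}$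 is an event, of probability $$\left(\sum_{i=0}^k\pi_i\sum_{n=i}^k c_n\right)\bigg/\left(1+\sum_{n=0}^k c_n\right),$$ which simplifies to $\sum_{i=0}^k\pi_i\frac{k+1-i}{k+2}$ if $p_i=p=q=q_i$ for all $i\ge0$. If the enumeration $(m_n)_{n\ge1}$ is increasing, the same holds for the set where $M(\Pi,\pi)\cong M_N$ for some $N$ with no prime factor greater than $m_k$. (In both cases $N=1$ is allowed.) -/

import Mathlib

/-! ### Infinite tensor products of matrix algebras -/

namespace RandomUHF

/-- The canonical orthonormal basis of the infinite tensor product of the pointed Hilbert spaces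
`(ℂ ^ (d n), e₀)`: elementary tensors `e_{x 0} ⊗ e_{x 1} ⊗ ⋯` with `x n < d n` for all `n` and
`x n = 0` for all but finitely many `n`. -/
abbrev TensorIndex (d : ℕ → ℕ) : Type := {x : ℕ →₀ ℕ // ∀ n, x n < d n}

/-- The infinite tensor product Hilbert space `⨂ₙ (ℂ ^ (d n), e₀)`, realised as `ℓ²` of its
canonical orthonormal basis. -/
abbrev TensorSpace (d : ℕ → ℕ) : Type := lp (fun _ : TensorIndex d => ℂ) 2

/-- Replace the `n`-th tensor factor `e_{x n}` by `e_j`. -/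
noncomputable def TensorIndex.set {d : ℕ → ℕ} (x : TensorIndex d) (n : ℕ) (j : Fin (d n)) :
    TensorIndex d :=
  ⟨x.1.update n j, fun k => by
    classical
    rw [Finsupp.update_apply]
    split_ifs with h
    · subst h; exact j.2
    · exact x.2 k⟩

theorem TensorIndex.set_injOn {d : ℕ → ℕ} (n : ℕ) (i j : Fin (d n)) :
    Set.InjOn (fun y : TensorIndex d => y.set n j) {y | y.1 n = i} := by
  classical
  intro y hy z hz h
  apply Subtype.ext
  ext k
  by_cases hk : k = n
  · subst hk; exact hy.trans hz.symm
  · have := DFunLike.congr_fun (congrArg Subtype.val h) k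
    simpa [TensorIndex.set, Finsupp.update_apply, hk] using this

/-- The action on coordinates of the operator `1 ⊗ ⋯ ⊗ 1 ⊗ e_{ij} ⊗ 1 ⊗ ⋯`, whose matrix unit
`e_{ij}` (sending `e_j` to `e_i` and all other `e_l` to `0`) sits in the `n`-th tensor factor. -/
noncomputable def unitFun {d : ℕ → ℕ} (n : ℕ) (i j : Fin (d n)) (f : TensorIndex d → ℂ) :
    TensorIndex d → ℂ :=
  fun y => if y.1 n = i then f (y.set n j) else 0

theorem unitFun_sum_le {d : ℕ → ℕ} (n : ℕ) (i j : Fin (d n)) (f : TensorSpace d)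
    (s : Finset (TensorIndex d)) :
    ∑ y ∈ s, ‖unitFun n i j f y‖ ^ (2 : ENNReal).toReal ≤ ‖f‖ ^ (2 : ENNReal).toReal := by
  classical
  have h1 : ∑ y ∈ s, ‖unitFun n i j f y‖ ^ (2 : ENNReal).toReal
      = ∑ y ∈ s with y.1 n = (i : ℕ), ‖f (y.set n j)‖ ^ (2 : ENNReal).toReal := by
    rw [Finset.sum_filter]
    refine Finset.sum_congr rfl fun y _ => ?_
    by_cases h : y.1 n = (i : ℕ) <;> simp [unitFun, h]
  rw [h1, ← Finset.sum_image (f := fun z => ‖f z‖ ^ (2 : ENNReal).toReal)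
    (g := fun y : TensorIndex d => y.set n j)]
  · exact lp.sum_rpow_le_norm_rpow (by simp) f _
  · intro y hy z hz h
    exact TensorIndex.set_injOn n i j (Finset.mem_filter.1 hy).2 (Finset.mem_filter.1 hz).2 h

/-- The bounded operator `1 ⊗ ⋯ ⊗ 1 ⊗ e_{ij} ⊗ 1 ⊗ ⋯`, with the matrix unit `e_{ij}` of
`M_{d n}` in the `n`-th tensor factor. -/
noncomputable def matrixUnit {d : ℕ → ℕ} (n : ℕ) (i j : Fin (d n)) :
    TensorSpace d →L[ℂ] TensorSpace d :=
  LinearMap.mkContinuous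
    { toFun := fun f => ⟨unitFun n i j f, memℓp_gen' (unitFun_sum_le n i j f)⟩
      map_add' := fun f g => by
        ext y
        change unitFun n i j (fun z => f z + g z) y = unitFun n i j f y + unitFun n i j g y
        by_cases h : y.1 n = i <;> simp [unitFun, h]
      map_smul' := fun c f => by
        ext y
        by_cases h : y.1 n = i <;> simp [unitFun, h] }
    1 (fun f => by
      rw [one_mul]
      exact lp.norm_le_of_forall_sum_le (by simp) (norm_nonneg f) (unitFun_sum_le n i j f))

/-- The infinite C*-tensor product `M_{d 0} ⊗ M_{d 1} ⊗ M_{d 2} ⊗ ⋯`, as a unital C*-algebra of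
bounded operators on `⨂ₙ (ℂ ^ (d n), e₀)`: the norm closure of the unital *-algebra generated
by the (commuting) copies of all the factors `M_{d n}`. -/
noncomputable def uhfSubalgebra (d : ℕ → ℕ) :
    StarSubalgebra ℂ (TensorSpace d →L[ℂ] TensorSpace d) :=
  (StarAlgebra.adjoin ℂ
    {T | ∃ (n : ℕ) (i j : Fin (d n)), T = matrixUnit n i j}).topologicalClosure

/-- The algebra `M_{d 0} ⊗ M_{d 1} ⊗ M_{d 2} ⊗ ⋯`. -/
abbrev UHF (d : ℕ → ℕ) : Type := uhfSubalgebra d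

/-- The universal UHF algebra `𝒬 = M_1 ⊗ M_2 ⊗ M_3 ⊗ ⋯`. -/
abbrev UniversalUHF : Type := UHF fun n => n + 1

/-- The supernatural number of a unital *-algebra, as the function that gives the exponent of
each prime: the exponent of `r` is the supremum of all `k` such that the algebra contains a
unital copy of `M_{r ^ k}`. -/
noncomputable def supernatural (A : Type*) [Ring A] [StarRing A] [Algebra ℂ A] :
    Nat.Primes → ℕ∞ :=
  fun r => ⨆ k : {k : ℕ //
    Nonempty (Matrix (Fin ((r : ℕ) ^ k)) (Fin ((r : ℕ) ^ k)) ℂ →⋆ₐ[ℂ] A)}, ((k : ℕ) : ℕ∞)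

/-- Finite type: each prime has finite multiplicity in the supernatural number. -/
def IsFiniteType (A : Type*) [Ring A] [StarRing A] [Algebra ℂ A] : Prop :=
  ∀ r : Nat.Primes, supernatural A r < ⊤

/-- `A` is isomorphic to a full matrix algebra `M_N` such that all prime factors of `N`
satisfy `C`. -/
def IsMatrixAlgebraWith (C : ℕ → Prop) (A : Type*) [Ring A] [StarRing A] [Algebra ℂ A] : Prop :=
  ∃ N : ℕ, Nonempty (A ≃⋆ₐ[ℂ] Matrix (Fin N) (Fin N) ℂ) ∧ ∀ r : ℕ, r.Prime → r ∣ N → C r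

/-! ### The birth-death chain on `{-1, 0, 1, 2, …}` -/

/-- `Y` is a Markov chain under `P` with initial distribution `ν` and transition matrix `T`: given
`Y 0 = x 0, …, Y n = x n`, the conditional probability of `Y (n + 1) = j` is `T (x n) j`. -/
structure IsMarkovChain {Ω : Type*} [MeasurableSpace Ω] (P : MeasureTheory.Measure Ω)
    (ν : ℤ → ℝ) (T : ℤ → ℤ → ℝ) (Y : ℕ → Ω → ℤ) : Prop where
  measurable : ∀ n, Measurable (Y n)
  initial : ∀ x, P.real {ω | Y 0 ω = x} = ν x
  step : ∀ (n : ℕ) (x : ℕ → ℤ) (j : ℤ),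
    P.real {ω | (∀ i ≤ n, Y i ω = x i) ∧ Y (n + 1) ω = j}
      = P.real {ω | ∀ i ≤ n, Y i ω = x i} * T (x n) j

/-- A distribution on `ℕ`, viewed as a distribution on `ℤ`. -/
def initialDist (π : ℕ → ℝ) : ℤ → ℝ
  | Int.ofNat i => π i
  | Int.negSucc _ => 0

/-- Transition matrix: from `i ≥ 0` the chain moves to `i + 1` with probability `p i` and to
`i - 1` with probability `q i`; the state `-1` is absorbing. (The states below `-1` are never
visited; they are absorbing too.) -/
def transition (p q : ℕ → ℝ) : ℤ → ℤ → ℝ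
  | Int.ofNat i, j => if j = (i : ℤ) + 1 then p i else if j = (i : ℤ) - 1 then q i else 0
  | Int.negSucc i, j => if j = Int.negSucc i then 1 else 0

/-- The labels `m_i`: `m_{-1} = m_0 = 1`, and `m_1, m_2, m_3, …` is the enumeration
`e 0, e 1, e 2, …` of the primes. -/
def label (e : ℕ ≃ Nat.Primes) : ℤ → ℕ
  | Int.ofNat (n + 1) => (e n : ℕ)
  | _ => 1

/-- The random algebra `M_{m_{Y_0}} ⊗ M_{m_{Y_1}} ⊗ M_{m_{Y_2}} ⊗ ⋯` at the sample point `ω`. -/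
abbrev RandomAlgebra {Ω : Type*} (e : ℕ ≃ Nat.Primes) (Y : ℕ → Ω → ℤ) (ω : Ω) : Type :=
  UHF fun n => label e (Y n ω)

/-- `c_n = ∏_{j=0}^{n} q_j / p_j`. -/
noncomputable def cSeq (p q : ℕ → ℝ) (n : ℕ) : ℝ := ∏ j ∈ Finset.range (n + 1), q j / p j

end RandomUHF

/-!
The theorem combines a dichotomy for UHF algebras, read off the sequence of tensor factors, with
the classical analysis of a birth-death chain.

**The algebras.** Whether `M_{d 0} ⊗ M_{d 1} ⊗ ⋯` has one of the properties in question depends only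
on how often each factor occurs.

* If only finitely many factors are nontrivial, the Hilbert space `⨂ₙ (ℂ ^ (d n), e₀)` is finite
  dimensional and the algebra consists of all operators on it, that is, it is `M_N` with
  `N = ∏ₙ d n`. Otherwise the corner matrix units of the nontrivial factors are infinitely many
  linearly independent elements. This gives `finiteDimensional_iff` and `isMatrixAlgebraWith_iff`.
* Grouping factors into finite blocks and reordering them is implemented by a unitary that permutes
  the canonical basis vectors, whence `nonempty_uhf_equiv_of_blocks`. If every prime occurs
  infinitely often, the factors can be grouped such that the block products are `1, 2, 3, …`, so the
  algebra is the universal UHF algebra.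
* A unital copy of `M_R` in the algebra forces `R` to divide the size of a finite tensor product
  (`exists_dvd_prod`). A minimal projection of `M_R` can be approximated by, and is then similar to,
  a projection on finitely many factors. The normalized traces of the compressions to the first `N`
  factors are asymptotically tracial on the whole algebra (`tendsto_approxTrace_commutator`), so the
  two projections have the same asymptotic trace: `1 / R` on the one hand, and on the other hand a
  fraction whose denominator is the size of the finite tensor product. Hence a prime that occurs
  finitely often has finite multiplicity in the supernatural number.

**The chain.** Everything follows from scale functions: functions `s` on the states, with increments
`w i = s i - s (i - 1) > 0`, such that `q i * w i = p i * w (i + 1)`. They are harmonic for the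
transition matrix, so the chain stopped on leaving an interval is turned into a bounded martingale.

* The martingale converges while each move changes its value, so the chain leaves every bounded
  interval. If `s` itself is bounded, every state is transient (`ae_eventually_ne_of_summable`); for
  a chain reflected at `0`, the function is only subharmonic at `0`, which suffices.
* Equating the mean of the stopped martingale at time zero with its limit gives the probability of
  reaching `-1` without visiting a state beyond `k` (`measureReal_ruin`), and letting `k` tend to
  infinity the probability of absorption (`measureReal_absorbed`). The latter is one if `s` is
  unbounded.
* For a reflected chain with unbounded `s`, the chain stopped at `0` and moved down by one state is
  such an absorbed chain. So `0` is reached again from any time on; and since the chain leaves every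
  interval by single steps, it visits all states infinitely often (`ae_frequently_eq`).
-/

/-! ### Markov chains with finitely many possible moves -/

namespace RandomUHF

open MeasureTheory Filter Topology

section Paths

variable {Ω : Type*} {Y : ℕ → Ω → ℤ}

/-- The first `n + 1` positions of the process. -/
def history (Y : ℕ → Ω → ℤ) (n : ℕ) (ω : Ω) : Fin (n + 1) → ℤ := fun i => Y i ω

theorem history_preimage_singleton (n : ℕ) (v : Fin (n + 1) → ℤ) :
    history Y n ⁻¹' {v}
      = {ω | ∀ i ≤ n, Y i ω = (fun i => if h : i < n + 1 then v ⟨i, h⟩ else 0) i} := by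
  ext ω
  simp only [Set.mem_preimage, Set.mem_singleton_iff, funext_iff, history, Set.mem_ofPred_eq]
  constructor
  · intro h i hi
    simp [Nat.lt_succ_of_le hi, ← h]
  · intro h i
    have := h i (Nat.le_of_lt_succ i.2)
    rwa [dif_pos i.2] at this

open Classical in
/-- The process stopped when it first enters `D`. The definition is recursive, so that no stopping
time is needed. -/
noncomputable def stopped (D : Set ℤ) (Y : ℕ → Ω → ℤ) : ℕ → Ω → ℤ
  | 0 => Y 0
  | n + 1 => fun ω => if stopped D Y n ω ∈ D then stopped D Y n ω else Y (n + 1) ω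

theorem stopped_succ_of_mem {D : Set ℤ} {n : ℕ} {ω : Ω} (h : stopped D Y n ω ∈ D) :
    stopped D Y (n + 1) ω = stopped D Y n ω := by
  simp [stopped, h]

theorem stopped_eq_of_forall_notMem {D : Set ℤ} {n : ℕ} {ω : Ω} (h : ∀ i < n, Y i ω ∉ D) :
    stopped D Y n ω = Y n ω := by
  induction n with
  | zero => rfl
  | succ n ih =>
    have := ih fun i hi => h i (by lia)
    simp [stopped, this, h n (by lia)]

theorem notMem_of_stopped_notMem {D : Set ℤ} {n : ℕ} {ω : Ω} (h : stopped D Y n ω ∉ D) :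
    ∀ i ≤ n, Y i ω ∉ D := by
  induction n with
  | zero => intro i hi; rw [Nat.le_zero.1 hi]; exact h
  | succ n ih =>
    have hn : stopped D Y n ω ∉ D := fun h' => h (by rwa [stopped_succ_of_mem h'])
    intro i hi
    rcases Nat.of_le_succ hi with hi | rfl
    · exact ih hn i hi
    · simpa [stopped, hn] using h

theorem stopped_eq_of_mem {D : Set ℤ} {n m : ℕ} {ω : Ω} (h : stopped D Y n ω ∈ D) (hnm : n ≤ m) :
    stopped D Y m ω = stopped D Y n ω := by
  induction hnm with
  | refl => rfl
  | step _ ih => rw [stopped_succ_of_mem (by rwa [ih]), ih]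

theorem exists_eq_stopped (D : Set ℤ) (n : ℕ) (ω : Ω) : ∃ i ≤ n, stopped D Y n ω = Y i ω := by
  induction n with
  | zero => exact ⟨0, le_rfl, rfl⟩
  | succ n ih =>
    by_cases h : stopped D Y n ω ∈ D
    · obtain ⟨i, hi, h'⟩ := ih
      exact ⟨i, by lia, by rw [stopped_succ_of_mem h, h']⟩
    · exact ⟨n + 1, le_rfl, by simp [stopped, h]⟩

end Paths

section Markov

variable {Ω : Type*} [MeasurableSpace Ω] {P : Measure Ω} {ν : ℤ → ℝ} {T : ℤ → ℤ → ℝ}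
  {Y : ℕ → Ω → ℤ}

/-- An integral is the sum of the integrals over the fibres of a map to a countable space. -/
theorem hasSum_setIntegral_fiber {E : Type*} [Countable E] [MeasurableSpace E]
    [MeasurableSingletonClass E] {G : Ω → E} (hG : Measurable G) {f : Ω → ℝ}
    (hf : Integrable f P) {s : Set Ω} (hs : MeasurableSet s) :
    HasSum (fun x => ∫ ω in s ∩ G ⁻¹' {x}, f ω ∂P) (∫ ω in s, f ω ∂P) := by
  have hU : (⋃ x, s ∩ G ⁻¹' {x}) = s := by ext ω; simp
  have h := hasSum_integral_iUnion (μ := P) (f := f) (s := fun x => s ∩ G ⁻¹' {x})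
    (fun x => hs.inter (hG (measurableSet_singleton x)))
    (fun x y hxy => by
      refine Set.disjoint_left.2 fun ω h1 h2 => hxy ?_
      rw [← h1.2, ← h2.2]) hf.integrableOn
  rwa [hU] at h

theorem hasSum_measureReal_fiber [IsFiniteMeasure P] {E : Type*} [Countable E] [MeasurableSpace E]
    [MeasurableSingletonClass E] {G : Ω → E} (hG : Measurable G) {s : Set Ω}
    (hs : MeasurableSet s) : HasSum (fun x => P.real (s ∩ G ⁻¹' {x})) (P.real s) := by
  simpa using hasSum_setIntegral_fiber (P := P) hG (integrable_const (1 : ℝ)) hs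

theorem measurable_history (hY : ∀ n, Measurable (Y n)) (n : ℕ) : Measurable (history Y n) :=
  measurable_pi_lambda _ fun i => hY i

theorem IsMarkovChain.step_history (hY : IsMarkovChain P ν T Y) (n : ℕ) (v : Fin (n + 1) → ℤ)
    (j : ℤ) : P.real (history Y n ⁻¹' {v} ∩ Y (n + 1) ⁻¹' {j})
      = P.real (history Y n ⁻¹' {v}) * T (v (Fin.last n)) j := by
  have h := hY.step n (fun i => if h : i < n + 1 then v ⟨i, h⟩ else 0) j
  rw [history_preimage_singleton]
  have hlast : (if h : n < n + 1 then v ⟨n, h⟩ else 0) = v (Fin.last n) :=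
    dif_pos (Nat.lt_succ_self n)
  rw [hlast] at h
  exact h

/-- Almost surely the chain makes only moves of positive probability. -/
theorem IsMarkovChain.ae_transition_ne_zero [IsFiniteMeasure P] (hY : IsMarkovChain P ν T Y) :
    ∀ᵐ ω ∂P, ∀ n, T (Y n ω) (Y (n + 1) ω) ≠ 0 := by
  refine ae_all_iff.2 fun n => ?_
  have h : ∀ (v : Fin (n + 1) → ℤ) (j : ℤ), ∀ᵐ ω ∂P, T (v (Fin.last n)) j = 0 →
      ¬ (history Y n ω = v ∧ Y (n + 1) ω = j) := by
    intro v j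
    by_cases h0 : T (v (Fin.last n)) j = 0
    · have := hY.step_history n v j
      rw [h0, mul_zero, measureReal_eq_zero_iff] at this
      filter_upwards [measure_eq_zero_iff_ae_notMem.1 this] with ω hω _ h
      exact hω h
    · exact Eventually.of_forall fun ω h => absurd h h0
  filter_upwards [ae_all_iff.2 fun v => ae_all_iff.2 (h v)] with ω hω h0
  exact hω (history Y n ω) (Y (n + 1) ω) h0 ⟨rfl, rfl⟩

/-- The filtration generated by the process. -/
def historyFiltration {m : MeasurableSpace Ω} (hY : ∀ n, Measurable (Y n)) : Filtration ℕ m where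
  seq n := MeasurableSpace.comap (history Y n) inferInstance
  mono' n k hnk := by
    have h : history Y n
        = (fun v : Fin (k + 1) → ℤ => fun i => v (Fin.castLE (by lia) i)) ∘ history Y k := rfl
    change MeasurableSpace.comap (history Y n) _ ≤ _
    rw [h, ← MeasurableSpace.comap_comp]
    exact MeasurableSpace.comap_mono (Measurable.comap_le (by fun_prop))
  le' n := (measurable_history hY n).comap_le

/-- A bounded function that is subharmonic for the transition matrix turns the chain into a
submartingale. The finite set `J x` has to contain all states that can be reached from `x` in one
step. -/
theorem IsMarkovChain.submartingale [IsFiniteMeasure P] (hY : IsMarkovChain P ν T Y) {φ : ℤ → ℝ}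
    {C : ℝ} (hC : ∀ x, |φ x| ≤ C) (J : ℤ → Finset ℤ) (hJ : ∀ x j, T x j ≠ 0 → j ∈ J x)
    (hφ : ∀ x, φ x ≤ ∑ j ∈ J x, T x j * φ j) :
    Submartingale (fun n ω => φ (Y n ω)) (historyFiltration hY.measurable) P := by
  have hmeas : ∀ n, Measurable fun ω => φ (Y n ω) := fun n =>
    (measurable_of_countable φ).comp (hY.measurable n)
  have hint : ∀ n, Integrable (fun ω => φ (Y n ω)) P := fun n =>
    Integrable.of_bound (hmeas n).aestronglyMeasurable C (ae_of_all _ fun ω => hC _)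
  refine submartingale_of_setIntegral_le_succ (fun n => ?_) hint fun n s hs => ?_
  · refine Measurable.stronglyMeasurable ?_
    have h : (fun ω => φ (Y n ω)) = (fun v : Fin (n + 1) → ℤ => φ (v (Fin.last n))) ∘ history Y n :=
      rfl
    rw [h]
    exact (measurable_of_countable _).comp (comap_measurable _)
  · obtain ⟨B, -, rfl⟩ := hs
    have hG := measurable_history hY.measurable n
    have hB : MeasurableSet (history Y n ⁻¹' B) := hG (Set.to_countable B).measurableSet
    refine hasSum_le (fun v => ?_) (hasSum_setIntegral_fiber hG (hint n) hB)
      (hasSum_setIntegral_fiber hG (hint (n + 1)) hB)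
    by_cases hv : v ∈ B
    swap
    · have : history Y n ⁻¹' B ∩ history Y n ⁻¹' {v} = ∅ := by
        ext ω; simp only [Set.mem_inter_iff, Set.mem_preimage, Set.mem_singleton_iff,
          Set.mem_empty_iff_false, iff_false, not_and]
        rintro h rfl; exact hv h
      simp [this]
    have hinter : history Y n ⁻¹' B ∩ history Y n ⁻¹' {v} = history Y n ⁻¹' {v} := by
      rw [← Set.preimage_inter, Set.inter_eq_right.2 (Set.singleton_subset_iff.2 hv)]
    rw [hinter]
    set A := history Y n ⁻¹' {v} with hA
    have hAm : MeasurableSet A := hG (measurableSet_singleton v)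
    set x := v (Fin.last n)
    have hYx : ∀ ω ∈ A, Y n ω = x := fun ω hω => congrFun (Set.mem_singleton_iff.1 hω) (Fin.last n)
    have h1 : ∫ ω in A, φ (Y n ω) ∂P = P.real A * φ x := by
      rw [setIntegral_congr_fun hAm (fun ω hω => by rw [hYx ω hω] : Set.EqOn _ (fun _ => φ x) A)]
      simp
    have h2 : ∫ ω in A, φ (Y (n + 1) ω) ∂P
        = ∫ ω in A, ∑ j ∈ J x, (Y (n + 1) ⁻¹' {j}).indicator (fun _ => φ j) ω ∂P := by
      refine setIntegral_congr_ae hAm ?_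
      filter_upwards [hY.ae_transition_ne_zero] with ω hω hωA
      have := hJ _ _ (hω n)
      rw [hYx ω hωA] at this
      rw [Finset.sum_eq_single_of_mem _ this]
      · simp
      · intro j _ hj
        simp [hj.symm]
    have h3 : ∫ ω in A, ∑ j ∈ J x, (Y (n + 1) ⁻¹' {j}).indicator (fun _ => φ j) ω ∂P
        = P.real A * ∑ j ∈ J x, T x j * φ j := by
      rw [integral_finsetSum _ fun j _ => ?_]
      · rw [Finset.mul_sum]
        refine Finset.sum_congr rfl fun j _ => ?_
        have hm : MeasurableSet (Y (n + 1) ⁻¹' {j}) :=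
          hY.measurable (n + 1) (measurableSet_singleton j)
        rw [integral_indicator_const _ hm, measureReal_restrict_apply hm, Set.inter_comm,
          hY.step_history, smul_eq_mul, mul_assoc]
      · exact (integrable_const _).indicator (hY.measurable (n + 1) (measurableSet_singleton j))
    rw [h1, h2, h3]
    exact mul_le_mul_of_nonneg_left (hφ x) measureReal_nonneg

/-- A bounded function that is harmonic for the transition matrix has constant mean along the
chain. -/
theorem IsMarkovChain.integral_harmonic [IsFiniteMeasure P] (hY : IsMarkovChain P ν T Y)
    {φ : ℤ → ℝ} {C : ℝ} (hC : ∀ x, |φ x| ≤ C) (J : ℤ → Finset ℤ)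
    (hJ : ∀ x j, T x j ≠ 0 → j ∈ J x) (hφ : ∀ x, φ x = ∑ j ∈ J x, T x j * φ j) (n : ℕ) :
    ∫ ω, φ (Y n ω) ∂P = ∫ ω, φ (Y 0 ω) ∂P := by
  have h1 := (hY.submartingale hC J hJ fun x => (hφ x).le).setIntegral_le (Nat.zero_le n)
    MeasurableSet.univ
  have h2 := (hY.submartingale (φ := fun x => - φ x) (C := C) (fun x => by simpa using hC x) J hJ
    fun x => by simp [← hφ x]).setIntegral_le (Nat.zero_le n) MeasurableSet.univ
  simp only [setIntegral_univ, integral_neg, neg_le_neg_iff] at h1 h2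
  exact le_antisymm h2 h1

/-- The values of a bounded subharmonic function along the chain converge almost surely. Hence a
state from which every possible move changes the value of the function is visited only finitely
often. -/
theorem IsMarkovChain.ae_eventually_ne [IsFiniteMeasure P] (hY : IsMarkovChain P ν T Y)
    {φ : ℤ → ℝ} {C : ℝ} (hC : ∀ x, |φ x| ≤ C) (J : ℤ → Finset ℤ)
    (hJ : ∀ x j, T x j ≠ 0 → j ∈ J x) (hφ : ∀ x, φ x ≤ ∑ j ∈ J x, T x j * φ j) :
    ∀ᵐ ω ∂P, ∀ x, (∀ j, T x j ≠ 0 → φ j ≠ φ x) → ∀ᶠ n in atTop, Y n ω ≠ x := by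
  have hsub := hY.submartingale hC J hJ hφ
  have hbdd : ∀ n, eLpNorm (fun ω => φ (Y n ω)) 1 P
      ≤ ((P Set.univ).toNNReal * C.toNNReal : NNReal) := by
    intro n
    refine (eLpNorm_le_of_ae_bound (C := C) (ae_of_all _ fun ω => hC _)).trans ?_
    simp [ENNReal.coe_toNNReal (measure_ne_top P _), ENNReal.ofReal]
  filter_upwards [hsub.exists_ae_tendsto_of_bdd hbdd, hY.ae_transition_ne_zero] with ω hω hstep
  intro x hx
  obtain ⟨c, hc⟩ := hω
  by_contra hfreq
  have hfreq : ∃ᶠ n in atTop, Y n ω = x := fun h => hfreq h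
  have hcx : c = φ x := by
    by_contra hne
    have := hc.eventually_ne hne
    exact hfreq (this.mono fun n hn h => hn (by rw [h]))
  subst hcx
  have hopen : (φ '' ↑{j ∈ J x | T x j ≠ 0})ᶜ ∈ 𝓝 (φ x) := by
    refine IsOpen.mem_nhds ?_ ?_
    · exact ((Finset.finite_toSet _).image φ).isClosed.isOpen_compl
    · rintro ⟨j, hj, hjx⟩
      simp only [ne_eq, Finset.coe_filter, Set.mem_ofPred_eq] at hj
      exact hx j hj.2 hjx
  have hev := (tendsto_add_atTop_iff_nat 1).2 hc |>.eventually hopen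
  refine hfreq (hev.mono fun n hn h => hn ⟨Y (n + 1) ω, ?_, rfl⟩)
  have := hstep n
  rw [h] at this
  simp [this, hJ _ _ this]

/-- The chain observed from time `1` on is a Markov chain. -/
theorem IsMarkovChain.shift_one [IsFiniteMeasure P] (hY : IsMarkovChain P ν T Y) :
    IsMarkovChain P (fun x => P.real (Y 1 ⁻¹' {x})) T fun n => Y (n + 1) where
  measurable n := hY.measurable (n + 1)
  initial x := rfl
  step n x j := by
    have hA : MeasurableSet {ω | ∀ i ≤ n, Y (i + 1) ω = x i} := by
      simp only [Set.ofPred_forall]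
      exact MeasurableSet.iInter fun i => MeasurableSet.iInter fun _ =>
        hY.measurable (i + 1) (measurableSet_singleton _)
    have hB : MeasurableSet {ω | (∀ i ≤ n, Y (i + 1) ω = x i) ∧ Y (n + 1 + 1) ω = j} :=
      hA.inter (hY.measurable (n + 1 + 1) (measurableSet_singleton j))
    refine (hasSum_measureReal_fiber (hY.measurable 0) hB).unique ?_
    refine ((hasSum_measureReal_fiber (P := P) (hY.measurable 0) hA).mul_right
      (T (x n) j)).congr_fun fun z => ?_
    have hz := hY.step (n + 1) (fun i => Nat.casesOn i z x) j
    have e1 : {ω | (∀ i ≤ n, Y (i + 1) ω = x i) ∧ Y (n + 1 + 1) ω = j} ∩ Y 0 ⁻¹' {z}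
        = {ω | (∀ i ≤ n + 1, Y i ω = (fun i => Nat.casesOn i z x : ℕ → ℤ) i)
          ∧ Y (n + 1 + 1) ω = j} := by
      ext ω
      simp only [Set.mem_inter_iff, Set.mem_ofPred_eq, Set.mem_preimage, Set.mem_singleton_iff]
      constructor
      · rintro ⟨⟨h1, h2⟩, h3⟩
        exact ⟨fun i hi => by cases i with | zero => exact h3 | succ i => exact h1 i (by lia), h2⟩
      · rintro ⟨h1, h2⟩
        exact ⟨⟨fun i hi => h1 (i + 1) (by lia), h2⟩, h1 0 (by lia)⟩
    have e2 : {ω | ∀ i ≤ n, Y (i + 1) ω = x i} ∩ Y 0 ⁻¹' {z}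
        = {ω | ∀ i ≤ n + 1, Y i ω = (fun i => Nat.casesOn i z x : ℕ → ℤ) i} := by
      ext ω
      simp only [Set.mem_inter_iff, Set.mem_ofPred_eq, Set.mem_preimage, Set.mem_singleton_iff]
      constructor
      · rintro ⟨h1, h3⟩ i hi
        cases i with | zero => exact h3 | succ i => exact h1 i (by lia)
      · intro h1
        exact ⟨fun i hi => h1 (i + 1) (by lia), h1 0 (by lia)⟩
    rw [e1, e2]
    exact hz

theorem IsMarkovChain.shift [IsFiniteMeasure P] (hY : IsMarkovChain P ν T Y) (N : ℕ) :
    IsMarkovChain P (fun x => P.real (Y N ⁻¹' {x})) T fun n => Y (n + N) := by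
  induction N with
  | zero =>
    have : (fun x => P.real (Y 0 ⁻¹' {x})) = ν := funext hY.initial
    rw [this]; exact hY
  | succ N ih =>
    have h := ih.shift_one
    simp only [Nat.add_right_comm _ 1 N, Nat.zero_add] at h
    exact h

open Classical in
/-- The transition matrix `T`, modified so that the states in `D` are absorbing. -/
noncomputable def absorbingOn (D : Set ℤ) (T : ℤ → ℤ → ℝ) (x j : ℤ) : ℝ :=
  if x ∈ D then if j = x then 1 else 0 else T x j

theorem measurable_stopped (hY : ∀ n, Measurable (Y n)) (D : Set ℤ) (n : ℕ) :
    Measurable (stopped D Y n) := by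
  induction n with
  | zero => exact hY 0
  | succ n ih =>
    exact Measurable.ite (ih (Set.to_countable D).measurableSet) ih (hY (n + 1))

/-- The chain stopped on entering `D` is the Markov chain for which `D` is absorbing. -/
theorem IsMarkovChain.stopped (hY : IsMarkovChain P ν T Y) (D : Set ℤ) :
    IsMarkovChain P ν (absorbingOn D T) (stopped D Y) where
  measurable n := measurable_stopped hY.measurable D n
  initial x := hY.initial x
  step n x j := by
    by_cases hD : x n ∈ D
    · have hstay : ∀ ω, (∀ i ≤ n, RandomUHF.stopped D Y i ω = x i) →
          RandomUHF.stopped D Y (n + 1) ω = x n := fun ω h => by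
        rw [stopped_succ_of_mem (by rwa [h n le_rfl]), h n le_rfl]
      by_cases hj : j = x n
      · simp only [absorbingOn, hD, hj, if_true, mul_one]
        congr 1
        ext ω
        exact ⟨fun h => h.1, fun h => ⟨h, hstay ω h⟩⟩
      · simp only [absorbingOn, hD, hj, if_true, if_false, mul_zero]
        convert! measureReal_empty (μ := P)
        ext ω
        simp only [Set.mem_ofPred_eq, Set.mem_empty_iff_false, iff_false, not_and]
        exact fun h h' => hj (h'.symm.trans (hstay ω h))
    · have hun : ∀ ω, (∀ i ≤ n, RandomUHF.stopped D Y i ω = x i) →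
          ∀ i ≤ n, Y i ω ∉ D := fun ω h =>
        notMem_of_stopped_notMem (by rwa [h n le_rfl])
      by_cases hall : ∀ i ≤ n, x i ∉ D
      · simp only [absorbingOn, hD, if_false]
        have key : ∀ ω, (∀ i ≤ n, RandomUHF.stopped D Y i ω = x i) ↔ ∀ i ≤ n, Y i ω = x i := by
          intro ω
          constructor
          · intro h i hi
            rw [← h i hi, stopped_eq_of_forall_notMem fun k hk => hun ω h k (by lia)]
          · intro h i hi
            rw [stopped_eq_of_forall_notMem fun k hk => by
              rw [h k (by lia)]; exact hall k (by lia), h i hi]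
        refine Eq.trans (congrArg P.real ?_) ((hY.step n x j).trans
          (congrArg (P.real · * T (x n) j) ?_))
        · ext ω
          simp only [Set.mem_ofPred_eq, key]
          refine and_congr_right fun h => ?_
          rw [stopped_eq_of_forall_notMem fun k hk => by
              rw [h k (by lia)]; exact hall k (by lia)]
        · simp only [key]
      · have hempty : {ω | ∀ i ≤ n, RandomUHF.stopped D Y i ω = x i} = ∅ := by
          ext ω
          simp only [Set.mem_ofPred_eq, Set.mem_empty_iff_false, iff_false]
          intro h
          refine hall fun i hi => ?_
          rw [← h i hi, stopped_eq_of_forall_notMem fun k hk => hun ω h k (by lia)]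
          exact hun ω h i hi
        rw [hempty, measureReal_empty, zero_mul]
        convert! measureReal_empty (μ := P)
        rw [← Set.subset_empty_iff, ← hempty]
        exact fun ω h => h.1

end Markov

end RandomUHF

/-! ### Birth-death chains: scale functions, exit from intervals and ruin -/

namespace RandomUHF

open MeasureTheory Filter Topology

section ScaleFunction

/-- The scale function with increments `w 0, w 1, …` between the states `-1, 0, 1, …`, which
vanishes at `-1` and below. -/
noncomputable def scale (w : ℕ → ℝ) (x : ℤ) : ℝ := ∑ n ∈ Finset.range (x + 1).toNat, w n

theorem scale_natCast (w : ℕ → ℝ) (i : ℕ) : scale w i = ∑ n ∈ Finset.range (i + 1), w n := by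
  simp [scale, show ((i : ℤ) + 1).toNat = i + 1 by lia]

theorem scale_of_neg (w : ℕ → ℝ) {x : ℤ} (hx : x < 0) : scale w x = 0 := by
  simp [scale, show (x + 1).toNat = 0 by lia]

theorem scale_natCast_sub_one (w : ℕ → ℝ) (i : ℕ) :
    scale w ((i : ℤ) - 1) = scale w i - w i := by
  rw [scale_natCast, Finset.sum_range_succ, scale]
  simp

theorem scale_natCast_add_one (w : ℕ → ℝ) (i : ℕ) :
    scale w ((i : ℤ) + 1) = scale w i + w (i + 1) := by
  have h : ((i : ℤ) + 1) = ((i + 1 : ℕ) : ℤ) := by push_cast; rfl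
  rw [h, scale_natCast, scale_natCast, Finset.sum_range_succ]

theorem scale_nonneg {w : ℕ → ℝ} (hw : ∀ n, 0 < w n) (x : ℤ) : 0 ≤ scale w x :=
  Finset.sum_nonneg fun n _ => (hw n).le

theorem scale_mono {w : ℕ → ℝ} (hw : ∀ n, 0 < w n) : Monotone (scale w) := fun x y hxy =>
  Finset.sum_le_sum_of_subset_of_nonneg
    (Finset.range_subset_range.2 (Int.toNat_le_toNat (by lia))) fun n _ _ => (hw n).le

theorem scale_natCast_pos {w : ℕ → ℝ} (hw : ∀ n, 0 < w n) (i : ℕ) : 0 < scale w i := by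
  rw [scale_natCast]
  exact Finset.sum_pos (fun n _ => hw n) (by simp)

end ScaleFunction

section Transition

variable {p q : ℕ → ℝ}

/-- The states that a birth-death chain can reach in one step; `x` itself is included for the sake
of absorbing states. -/
def neighbours (x : ℤ) : Finset ℤ := {x - 1, x, x + 1}

theorem sum_neighbours (x : ℤ) (f : ℤ → ℝ) :
    ∑ j ∈ neighbours x, f j = f (x - 1) + f x + f (x + 1) := by
  rw [neighbours, Finset.sum_insert (by simp; lia), Finset.sum_insert (by simp),
    Finset.sum_singleton, add_assoc]

theorem transition_natCast (i : ℕ) (j : ℤ) :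
    transition p q i j = if j = (i : ℤ) + 1 then p i else if j = (i : ℤ) - 1 then q i else 0 :=
  rfl

theorem transition_of_neg {x : ℤ} (hx : x < 0) (j : ℤ) :
    transition p q x j = if j = x then 1 else 0 := by
  obtain ⟨m, rfl⟩ := Int.eq_negSucc_of_lt_zero hx
  rfl

theorem mem_neighbours_of_transition_ne_zero (D : Set ℤ) (x j : ℤ)
    (h : absorbingOn D (transition p q) x j ≠ 0) : j ∈ neighbours x := by
  classical
  have hx : x ∈ neighbours x := by simp [neighbours]
  unfold absorbingOn at h
  split_ifs at h with h1 h2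
  · rwa [h2]
  · exact absurd rfl h
  · rcases lt_or_ge x 0 with hx0 | hx0
    · rw [transition_of_neg hx0] at h
      split_ifs at h with h2
      · rwa [h2]
      · exact absurd rfl h
    · lift x to ℕ using hx0
      rw [transition_natCast] at h
      split_ifs at h with h2 h3
      · simp [neighbours, h2]
      · simp [neighbours, h3]
      · exact absurd rfl h

theorem transition_step {x j : ℤ} (h : transition p q x j ≠ 0) :
    (x < 0 ∧ j = x) ∨ (0 ≤ x ∧ (j = x + 1 ∨ (j = x - 1 ∧ q x.toNat ≠ 0))) := by
  rcases lt_or_ge x 0 with hx0 | hx0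
  · rw [transition_of_neg hx0] at h
    split_ifs at h with h2
    · exact Or.inl ⟨hx0, h2⟩
    · exact absurd rfl h
  · lift x to ℕ using hx0
    rw [transition_natCast] at h
    split_ifs at h with h2 h3
    · exact Or.inr ⟨by lia, Or.inl h2⟩
    · exact Or.inr ⟨by lia, Or.inr ⟨h3, by simpa using h⟩⟩
    · exact absurd rfl h

theorem sum_absorbingOn_of_mem {D : Set ℤ} {x : ℤ} (hx : x ∈ D) (φ : ℤ → ℝ) :
    ∑ j ∈ neighbours x, absorbingOn D (transition p q) x j * φ j = φ x := by
  rw [sum_neighbours]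
  simp [absorbingOn, hx]

theorem sum_absorbingOn_of_neg {D : Set ℤ} {x : ℤ} (hx : x < 0) (φ : ℤ → ℝ) :
    ∑ j ∈ neighbours x, absorbingOn D (transition p q) x j * φ j = φ x := by
  by_cases hD : x ∈ D
  · exact sum_absorbingOn_of_mem hD φ
  · rw [sum_neighbours]
    simp [absorbingOn, hD, transition_of_neg hx]

theorem sum_absorbingOn_natCast {D : Set ℤ} {i : ℕ} (hi : (i : ℤ) ∉ D) (φ : ℤ → ℝ) :
    ∑ j ∈ neighbours i, absorbingOn D (transition p q) i j * φ j
      = p i * φ (i + 1) + q i * φ (i - 1) := by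
  have h : (i : ℤ) - 1 ≠ i + 1 := by lia
  rw [sum_neighbours]
  simp [absorbingOn, hi, transition_natCast, h, show (i : ℤ) ≠ i - 1 by lia, add_comm]

/-- A truncation of a scale function at a state `b` with `b` absorbing, or a bounded scale function
(no truncation, no absorption), is subharmonic as soon as `q i * w i ≤ p i * w (i + 1)`. -/
theorem subharmonic_of_increments {D : Set ℤ} {φ : ℤ → ℝ} {w : ℕ → ℝ} (hpq : ∀ i, p i + q i = 1)
    (hw : ∀ i, q i * w i ≤ p i * w (i + 1))
    (h1 : ∀ i : ℕ, (i : ℤ) ∉ D → φ (i + 1) = φ i + w (i + 1))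
    (h2 : ∀ i : ℕ, (i : ℤ) ∉ D → φ (i - 1) = φ i - w i) (x : ℤ) :
    φ x ≤ ∑ j ∈ neighbours x, absorbingOn D (transition p q) x j * φ j := by
  by_cases hD : x ∈ D
  · rw [sum_absorbingOn_of_mem hD]
  rcases lt_or_ge x 0 with hx0 | hx0
  · rw [sum_absorbingOn_of_neg hx0]
  · lift x to ℕ using hx0
    rw [sum_absorbingOn_natCast hD, h1 x hD, h2 x hD]
    linear_combination hw x - φ x * hpq x

theorem harmonic_of_increments {D : Set ℤ} {φ : ℤ → ℝ} {w : ℕ → ℝ} (hpq : ∀ i, p i + q i = 1)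
    (hw : ∀ i, q i * w i = p i * w (i + 1))
    (h1 : ∀ i : ℕ, (i : ℤ) ∉ D → φ (i + 1) = φ i + w (i + 1))
    (h2 : ∀ i : ℕ, (i : ℤ) ∉ D → φ (i - 1) = φ i - w i) (x : ℤ) :
    φ x = ∑ j ∈ neighbours x, absorbingOn D (transition p q) x j * φ j := by
  by_cases hD : x ∈ D
  · rw [sum_absorbingOn_of_mem hD]
  rcases lt_or_ge x 0 with hx0 | hx0
  · rw [sum_absorbingOn_of_neg hx0]
  · lift x to ℕ using hx0
    rw [sum_absorbingOn_natCast hD, h1 x hD, h2 x hD]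
    linear_combination hw x - φ x * hpq x

theorem ne_of_increments {D : Set ℤ} {φ : ℤ → ℝ} {w : ℕ → ℝ} (hw : ∀ n, 0 < w n)
    (h1 : ∀ i : ℕ, (i : ℤ) ∉ D → φ (i + 1) = φ i + w (i + 1))
    (h2 : ∀ i : ℕ, (i : ℤ) ∉ D → φ (i - 1) = φ i - w i) {i : ℕ} (hi : (i : ℤ) ∉ D) {j : ℤ}
    (hj : absorbingOn D (transition p q) i j ≠ 0) : φ j ≠ φ i := by
  simp only [absorbingOn, hi, if_false] at hj
  rcases transition_step hj with h | ⟨-, rfl | ⟨rfl, -⟩⟩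
  · lia
  · rw [h1 i hi]; linarith [hw (i + 1)]
  · rw [h2 i hi]; linarith [hw i]

theorem absorbingOn_empty (T : ℤ → ℤ → ℝ) : absorbingOn ∅ T = T := by
  ext x j; simp [absorbingOn]

theorem scale_min_increments (w : ℕ → ℝ) (b : ℤ) (i : ℕ) (hi : (i : ℤ) ∉ Set.Ici b) :
    scale w (min (i + 1) b) = scale w (min i b) + w (i + 1)
      ∧ scale w (min (i - 1) b) = scale w (min i b) - w i := by
  have hi' : (i : ℤ) < b := not_le.1 hi
  rw [min_eq_left hi'.le, min_eq_left (by lia), min_eq_left (by lia)]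
  exact ⟨scale_natCast_add_one w i, scale_natCast_sub_one w i⟩

theorem abs_scale_min_le {w : ℕ → ℝ} (hw : ∀ n, 0 < w n) (b x : ℤ) :
    |scale w (min x b)| ≤ scale w b := by
  rw [abs_of_nonneg (scale_nonneg hw _)]
  exact scale_mono hw (min_le_right _ _)

end Transition

section Chain

variable {Ω : Type*} [MeasurableSpace Ω] {P : Measure Ω} [IsProbabilityMeasure P]
  {ν : ℤ → ℝ} {p q : ℕ → ℝ} {Y : ℕ → Ω → ℤ}

/-- A birth-death chain stopped at the level `b` is eventually outside the interval `[0, b)`: the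
truncated scale function is bounded and subharmonic, and every move from a state in the interval
changes its value. -/
theorem ae_eventually_stopped_notMem (hpq : ∀ i, p i + q i = 1)
    (hY : IsMarkovChain P ν (transition p q) Y) {w : ℕ → ℝ} (hw0 : ∀ n, 0 < w n)
    (hw : ∀ i, q i * w i ≤ p i * w (i + 1)) (b : ℕ) :
    ∀ᵐ ω ∂P, ∀ᶠ n in atTop,
      stopped (Set.Ici (b : ℤ)) Y n ω < 0 ∨ (b : ℤ) ≤ stopped (Set.Ici (b : ℤ)) Y n ω := by
  have hinc := scale_min_increments w b
  have h := (hY.stopped (Set.Ici (b : ℤ))).ae_eventually_ne (φ := fun x => scale w (min x b))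
    (abs_scale_min_le hw0 b) neighbours (mem_neighbours_of_transition_ne_zero _)
    (subharmonic_of_increments hpq hw (fun i hi => (hinc i hi).1) fun i hi => (hinc i hi).2)
  filter_upwards [h] with ω hω
  have hall : ∀ᶠ n in atTop, ∀ i ∈ Finset.range b, stopped (Set.Ici (b : ℤ)) Y n ω ≠ i := by
    refine (Filter.eventually_all_finset _).2 fun i hi => hω i fun j hj => ?_
    have hib : (i : ℤ) ∉ Set.Ici (b : ℤ) := by
      have := Finset.mem_range.1 hi
      simpa using this
    exact ne_of_increments (φ := fun x => scale w (min x b)) hw0 (fun i hi => (hinc i hi).1)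
      (fun i hi => (hinc i hi).2) hib hj
  filter_upwards [hall] with n hn
  by_contra! hcon
  obtain ⟨h0, h1⟩ := hcon
  refine hn (stopped (Set.Ici (b : ℤ)) Y n ω).toNat (by rw [Finset.mem_range]; lia) (by lia)

theorem ae_exists_exit (hpq : ∀ i, p i + q i = 1)
    (hY : IsMarkovChain P ν (transition p q) Y) {w : ℕ → ℝ} (hw0 : ∀ n, 0 < w n)
    (hw : ∀ i, q i * w i ≤ p i * w (i + 1)) (b : ℕ) :
    ∀ᵐ ω ∂P, ∃ n, Y n ω < 0 ∨ (b : ℤ) ≤ Y n ω := by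
  filter_upwards [ae_eventually_stopped_notMem hpq hY hw0 hw b] with ω hω
  obtain ⟨n, hn⟩ := hω.exists
  obtain ⟨i, -, hi⟩ := exists_eq_stopped (Y := Y) (Set.Ici (b : ℤ)) n ω
  exact ⟨i, by rwa [← hi]⟩

/-- If some bounded scale function is subharmonic, then every state `i ≥ 0` is transient. -/
theorem ae_eventually_ne_of_summable (hpq : ∀ i, p i + q i = 1)
    (hY : IsMarkovChain P ν (transition p q) Y) {w : ℕ → ℝ} (hw0 : ∀ n, 0 < w n)
    (hw : ∀ i, q i * w i ≤ p i * w (i + 1)) (hsum : Summable w) :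
    ∀ᵐ ω ∂P, ∀ i : ℕ, ∀ᶠ n in atTop, Y n ω ≠ i := by
  have h1 : ∀ i : ℕ, (i : ℤ) ∉ (∅ : Set ℤ) → scale w (i + 1) = scale w i + w (i + 1) :=
    fun i _ => scale_natCast_add_one w i
  have h2 : ∀ i : ℕ, (i : ℤ) ∉ (∅ : Set ℤ) → scale w (i - 1) = scale w i - w i :=
    fun i _ => scale_natCast_sub_one w i
  have hY' : IsMarkovChain P ν (absorbingOn ∅ (transition p q)) Y := by rwa [absorbingOn_empty]
  filter_upwards [hY'.ae_eventually_ne (φ := scale w) (C := ∑' n, w n)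
    (fun x => by
      rw [abs_of_nonneg (scale_nonneg hw0 x)]
      exact hsum.sum_le_tsum _ fun n _ => (hw0 n).le) neighbours
    (mem_neighbours_of_transition_ne_zero _) (subharmonic_of_increments hpq hw h1 h2)] with ω hω i
  exact hω i fun j hj => ne_of_increments hw0 h1 h2 (Set.notMem_empty _) hj

theorem IsMarkovChain.ae_step (hY : IsMarkovChain P ν (transition p q) Y) :
    ∀ᵐ ω ∂P, ∀ n, (Y n ω < 0 ∧ Y (n + 1) ω = Y n ω) ∨ (0 ≤ Y n ω ∧ (Y (n + 1) ω = Y n ω + 1 ∨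
      (Y (n + 1) ω = Y n ω - 1 ∧ q (Y n ω).toNat ≠ 0))) := by
  filter_upwards [hY.ae_transition_ne_zero] with ω hω n
  exact transition_step (hω n)

theorem eq_of_neg {y : ℕ → ℤ} (h : ∀ n, y n < 0 → y (n + 1) = y n) {n m : ℕ} (hn : y n < 0)
    (hnm : n ≤ m) : y m = y n := by
  induction hnm with
  | refl => rfl
  | step _ ih => rw [h _ (by rwa [ih]), ih]

/-- The probability of ruin (reaching `-1`) from `x` without visiting a state beyond `k`. -/
noncomputable def ruin (w : ℕ → ℝ) (k : ℕ) (x : ℤ) : ℝ :=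
  1 - scale w (min x (k + 1 : ℕ)) / scale w (k + 1 : ℕ)

theorem ruin_of_neg (w : ℕ → ℝ) (k : ℕ) {x : ℤ} (hx : x < 0) : ruin w k x = 1 := by
  rw [ruin, scale_of_neg w (by lia)]; simp

theorem ruin_of_le {w : ℕ → ℝ} (hw : ∀ n, 0 < w n) (k : ℕ) {x : ℤ} (hx : ((k + 1 : ℕ) : ℤ) ≤ x) :
    ruin w k x = 0 := by
  rw [ruin, min_eq_right hx, div_self (scale_natCast_pos hw _).ne', sub_self]

theorem abs_ruin_le {w : ℕ → ℝ} (hw : ∀ n, 0 < w n) (k : ℕ) (x : ℤ) : |ruin w k x| ≤ 1 := by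
  have h1 := abs_scale_min_le hw (k + 1 : ℕ) x
  have h2 := scale_nonneg hw (min x (k + 1 : ℕ))
  have h3 := scale_natCast_pos hw (k + 1)
  rw [abs_of_nonneg h2] at h1
  have h4 := div_le_one_of_le₀ h1 h3.le
  have h5 := div_nonneg h2 h3.le
  rw [ruin, abs_le]
  constructor <;> linarith

theorem measurableSet_ruin (hY : ∀ n, Measurable (Y n)) (k : ℕ) :
    MeasurableSet {ω | (∃ n, Y n ω < 0) ∧ ∀ n, Y n ω ≤ k} := by
  simp only [Set.ofPred_and, Set.ofPred_exists, Set.ofPred_forall]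
  exact (MeasurableSet.iUnion fun n => hY n measurableSet_Iio).inter
    (MeasurableSet.iInter fun n => hY n measurableSet_Iic)

/-- Gambler's ruin: the function `ruin w k` is harmonic for the chain stopped above `k`, and along
this chain it converges to the indicator function of the event of ruin. -/
theorem measureReal_ruin (hpq : ∀ i, p i + q i = 1)
    (hY : IsMarkovChain P ν (transition p q) Y) {w : ℕ → ℝ} (hw0 : ∀ n, 0 < w n)
    (hw : ∀ i, q i * w i = p i * w (i + 1)) (k : ℕ) :
    P.real {ω | (∃ n, Y n ω < 0) ∧ ∀ n, Y n ω ≤ k} = ∫ ω, ruin w k (Y 0 ω) ∂P := by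
  set D : Set ℤ := Set.Ici ((k + 1 : ℕ) : ℤ) with hD
  -- The event of ruin.
  set G := {ω | (∃ n, Y n ω < 0) ∧ ∀ n, Y n ω ≤ k} with hG
  have hinc := scale_min_increments w (k + 1 : ℕ)
  have hX := hY.stopped D
  have hharm : ∀ x, ruin w k x
      = ∑ j ∈ neighbours x, absorbingOn D (transition p q) x j * ruin w k j := by
    refine harmonic_of_increments (w := fun n => - w n / scale w (k + 1 : ℕ)) hpq (fun i => ?_)
      (fun i hi => ?_) fun i hi => ?_
    · linear_combination (-1 / scale w (k + 1 : ℕ)) * hw i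
    · rw [ruin, ruin, (hinc i hi).1]; ring
    · rw [ruin, ruin, (hinc i hi).2]; ring
  have hmean := hX.integral_harmonic (abs_ruin_le hw0 k) neighbours
    (mem_neighbours_of_transition_ne_zero _) hharm
  have hlim : ∀ᵐ ω ∂P, Tendsto (fun n => ruin w k (stopped D Y n ω)) atTop
      (𝓝 (G.indicator (fun _ => (1 : ℝ)) ω)) := by
    filter_upwards [ae_eventually_stopped_notMem hpq hY hw0 (fun i => (hw i).le) (k + 1),
      hY.ae_step] with ω hω hstep
    obtain ⟨n, hn⟩ := hω.exists
    refine tendsto_const_nhds.congr' ?_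
    rcases hn with hn | hn
    · have hnD : stopped D Y n ω ∉ D := by simp only [hD, Set.mem_Ici]; lia
      have hlt := notMem_of_stopped_notMem hnD
      have hYn : stopped D Y n ω = Y n ω :=
        stopped_eq_of_forall_notMem fun i hi => hlt i hi.le
      rw [hYn] at hn
      have hconst : ∀ m, n ≤ m → Y m ω = Y n ω := fun m hm =>
        eq_of_neg (y := fun n => Y n ω) (fun i hi => by
          rcases hstep i with h | h
          · exact h.2
          · lia) hn hm
      have hmemG : ω ∈ G := by
        refine ⟨⟨n, hn⟩, fun m => ?_⟩
        rcases le_total m n with hm | hm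
        · have := hlt m hm
          simp only [hD, Set.mem_Ici] at this
          lia
        · rw [hconst m hm]; lia
      filter_upwards [eventually_ge_atTop n] with m hm
      have hlt' : ∀ i < m, Y i ω ∉ D := fun i _ => by
        have := hmemG.2 i
        simp only [hD, Set.mem_Ici]; lia
      rw [stopped_eq_of_forall_notMem hlt', hconst m hm, ruin_of_neg w k hn]
      simp [hmemG]
    · have hnotG : ω ∉ G := fun h => by
        obtain ⟨i, -, hi⟩ := exists_eq_stopped (Y := Y) D n ω
        have := h.2 i
        rw [hi] at hn
        lia
      filter_upwards [eventually_ge_atTop n] with m hm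
      rw [stopped_eq_of_mem hn hm, ruin_of_le hw0 k hn]
      simp [hnotG]
  have hGm : MeasurableSet G := measurableSet_ruin hY.measurable k
  have h1 := tendsto_integral_of_dominated_convergence (fun _ => (1 : ℝ))
    (fun n => ((measurable_of_countable (ruin w k)).comp (hX.measurable n)).aestronglyMeasurable)
    (integrable_const _) (fun n => ae_of_all _ fun ω => abs_ruin_le hw0 k _) hlim
  simp only [Function.comp_apply, hmean] at h1
  have h2 := tendsto_nhds_unique h1 tendsto_const_nhds
  rw [integral_indicator_const _ hGm, smul_eq_mul, mul_one] at h2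
  rw [h2]
  rfl

/-- The probability that the chain is absorbed, as the limit of the ruin probabilities. -/
theorem measureReal_absorbed (hpq : ∀ i, p i + q i = 1)
    (hY : IsMarkovChain P ν (transition p q) Y) {w : ℕ → ℝ} (hw0 : ∀ n, 0 < w n)
    (hw : ∀ i, q i * w i = p i * w (i + 1)) {ψ : ℤ → ℝ}
    (hψ : ∀ x, Tendsto (fun k => ruin w k x) atTop (𝓝 (ψ x))) :
    P.real {ω | ∃ n, Y n ω < 0} = ∫ ω, ψ (Y 0 ω) ∂P := by
  have h1 : Tendsto (fun k => ∫ ω, ruin w k (Y 0 ω) ∂P) atTop (𝓝 (∫ ω, ψ (Y 0 ω) ∂P)) :=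
    tendsto_integral_of_dominated_convergence (fun _ => (1 : ℝ))
      (fun n => ((measurable_of_countable (ruin w n)).comp (hY.measurable 0)).aestronglyMeasurable)
      (integrable_const _) (fun n => ae_of_all _ fun ω => abs_ruin_le hw0 n _)
      (ae_of_all _ fun ω => hψ _)
  simp only [← measureReal_ruin hpq hY hw0 hw] at h1
  have hmono : Monotone fun k : ℕ => {ω | (∃ n, Y n ω < 0) ∧ ∀ n, Y n ω ≤ k} :=
    fun k l hkl ω h => ⟨h.1, fun n => (h.2 n).trans (by exact_mod_cast hkl)⟩
  have h2 := tendsto_measure_iUnion_atTop (μ := P) hmono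
  have h3 := (ENNReal.tendsto_toReal (measure_ne_top P _)).comp h2
  refine (measureReal_congr ?_).trans (tendsto_nhds_unique h3 h1)
  filter_upwards [hY.ae_step] with ω hstep
  refine propext ⟨fun h => ?_, fun h => ?_⟩
  · obtain ⟨n, hn⟩ := h
    have hconst : ∀ m, n ≤ m → Y m ω = Y n ω := fun m hm =>
      eq_of_neg (y := fun n => Y n ω) (fun i hi => by
        rcases hstep i with h | h
        · exact h.2
        · lia) hn hm
    refine Set.mem_iUnion.2 ⟨((Finset.range n).sup fun i => (Y i ω).toNat), ⟨n, hn⟩, fun m => ?_⟩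
    rcases lt_or_ge m n with hm | hm
    · have := Finset.le_sup (f := fun i => (Y i ω).toNat) (Finset.mem_range.2 hm)
      lia
    · rw [hconst m hm]; lia
  · obtain ⟨k, hk⟩ := Set.mem_iUnion.1 h
    exact hk.1

theorem tendsto_ruin_of_not_summable {w : ℕ → ℝ} (hw0 : ∀ n, 0 < w n) (hsum : ¬ Summable w)
    (x : ℤ) : Tendsto (fun k => ruin w k x) atTop (𝓝 1) := by
  have h1 : Tendsto (fun k : ℕ => scale w (k + 1 : ℕ)) atTop atTop := by
    simp only [scale_natCast]
    exact ((not_summable_iff_tendsto_nat_atTop_of_nonneg fun n => (hw0 n).le).1 hsum).comp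
      (tendsto_atTop_mono (fun k => by lia : ∀ k, k ≤ k + 1 + 1) tendsto_id)
  have h2 : Tendsto (fun k : ℕ => scale w x / scale w (k + 1 : ℕ)) atTop (𝓝 0) :=
    h1.const_div_atTop _
  have h3 := h2.const_sub 1
  rw [sub_zero] at h3
  refine h3.congr' ?_
  filter_upwards [eventually_ge_atTop x.toNat] with k hk
  rw [ruin, min_eq_left (by lia)]

theorem tendsto_ruin_of_summable {w : ℕ → ℝ} (hw0 : ∀ n, 0 < w n) (hsum : Summable w)
    (x : ℤ) : Tendsto (fun k => ruin w k x) atTop (𝓝 (1 - scale w x / ∑' n, w n)) := by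
  have h1 : Tendsto (fun k : ℕ => scale w (k + 1 : ℕ)) atTop (𝓝 (∑' n, w n)) := by
    simp only [scale_natCast]
    exact hsum.hasSum.tendsto_sum_nat.comp
      (tendsto_atTop_mono (fun k => by lia : ∀ k, k ≤ k + 1 + 1) tendsto_id)
  have hpos : 0 < ∑' n, w n := hsum.tsum_pos (fun n => (hw0 n).le) 0 (hw0 0)
  have h3 := ((tendsto_const_nhds (x := scale w x)).div h1 hpos.ne').const_sub 1
  refine h3.congr' ?_
  filter_upwards [eventually_ge_atTop x.toNat] with k hk
  rw [ruin, min_eq_left (by lia), Pi.div_apply]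

/-- The mean of a bounded function of the initial position. -/
theorem IsMarkovChain.hasSum_initial {π : ℕ → ℝ} {T : ℤ → ℤ → ℝ}
    (hY : IsMarkovChain P (initialDist π) T Y) {g : ℤ → ℝ} {C : ℝ} (hg : ∀ x, |g x| ≤ C) :
    HasSum (fun i : ℕ => π i * g i) (∫ ω, g (Y 0 ω) ∂P) := by
  have hint : Integrable (fun ω => g (Y 0 ω)) P := Integrable.of_bound
    ((measurable_of_countable g).comp (hY.measurable 0)).aestronglyMeasurable C
    (ae_of_all _ fun ω => hg _)
  have h := hasSum_setIntegral_fiber (hY.measurable 0) hint MeasurableSet.univ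
  have h' : ∀ x, ∫ ω in Set.univ ∩ Y 0 ⁻¹' {x}, g (Y 0 ω) ∂P = initialDist π x * g x := by
    intro x
    have hm : MeasurableSet (Y 0 ⁻¹' {x}) := hY.measurable 0 (measurableSet_singleton x)
    rw [Set.univ_inter, setIntegral_congr_fun hm
      (fun ω hω => by rw [show Y 0 ω = x from hω] : Set.EqOn _ (fun _ => g x) _)]
    have := hY.initial x
    simp only [integral_const, smul_eq_mul, measureReal_restrict_apply_univ]
    rw [← this]
    rfl
  simp only [h', setIntegral_univ] at h
  refine ((Function.Injective.hasSum_iff (g := fun i : ℕ => (i : ℤ)) Nat.cast_injective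
    fun x hx => ?_).2 h :)
  cases x with
  | ofNat i => exact absurd ⟨i, rfl⟩ hx
  | negSucc i => simp [initialDist]

theorem IsMarkovChain.ae_initial_nonneg {π : ℕ → ℝ} {T : ℤ → ℤ → ℝ}
    (hY : IsMarkovChain P (initialDist π) T Y) : ∀ᵐ ω ∂P, 0 ≤ Y 0 ω := by
  have h : ∀ i : ℕ, ∀ᵐ ω ∂P, Y 0 ω ≠ Int.negSucc i := by
    intro i
    have := hY.initial (Int.negSucc i)
    rw [initialDist, measureReal_eq_zero_iff] at this
    exact measure_eq_zero_iff_ae_notMem.1 this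
  filter_upwards [ae_all_iff.2 h] with ω hω
  by_contra hneg
  obtain ⟨m, hm⟩ := Int.eq_negSucc_of_lt_zero (not_le.1 hneg)
  exact hω m hm

end Chain

end RandomUHF

/-! ### Recurrence, transience and absorption probabilities -/

namespace RandomUHF

open MeasureTheory Filter Topology

section Weights

variable {p q : ℕ → ℝ}

/-- The increments of the harmonic scale function of the chain absorbed at `-1`. -/
noncomputable def absorbingWeight (p q : ℕ → ℝ) : ℕ → ℝ
  | 0 => 1
  | n + 1 => cSeq p q n

/-- The increments of the scale function of the chain reflected at `0`; this function is harmonic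
except at `0`. -/
noncomputable def reflectingWeight (p q : ℕ → ℝ) : ℕ → ℝ
  | 0 => 1
  | n + 1 => ∏ i ∈ Finset.Icc 1 n, q i / p i

theorem cSeq_succ (n : ℕ) : cSeq p q (n + 1) = cSeq p q n * (q (n + 1) / p (n + 1)) :=
  Finset.prod_range_succ _ _

theorem absorbingWeight_pos (hp : ∀ i, 0 < p i) (hq : ∀ i, 0 < q i) (n : ℕ) :
    0 < absorbingWeight p q n := by
  cases n with
  | zero => exact one_pos
  | succ n =>
    rw [absorbingWeight, cSeq]
    exact Finset.prod_pos fun i _ => div_pos (hq i) (hp i)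

theorem absorbingWeight_harmonic (hp : ∀ i, 0 < p i) (i : ℕ) :
    q i * absorbingWeight p q i = p i * absorbingWeight p q (i + 1) := by
  have := (hp i).ne'
  cases i with
  | zero => simp only [absorbingWeight, cSeq, zero_add, Finset.prod_range_one]; field_simp
  | succ n => simp only [absorbingWeight, cSeq_succ]; field_simp

theorem summable_absorbingWeight : Summable (absorbingWeight p q) ↔ Summable (cSeq p q) :=
  (summable_nat_add_iff 1 (f := absorbingWeight p q)).symm

theorem reflectingWeight_pos (hp : ∀ i, 0 < p i) (hq : ∀ i, 1 ≤ i → 0 < q i) (n : ℕ) :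
    0 < reflectingWeight p q n := by
  cases n with
  | zero => exact one_pos
  | succ n => exact Finset.prod_pos fun i hi => div_pos (hq i (Finset.mem_Icc.1 hi).1) (hp i)

theorem reflectingWeight_subharmonic (hp : ∀ i, 0 < p i) (hq₀ : q 0 = 0) (i : ℕ) :
    q i * reflectingWeight p q i ≤ p i * reflectingWeight p q (i + 1) := by
  cases i with
  | zero => simp [reflectingWeight, hq₀, (hp 0).le]
  | succ n =>
    have := (hp (n + 1)).ne'
    refine le_of_eq ?_
    simp only [reflectingWeight, Finset.prod_Icc_succ_top (Nat.le_add_left 1 n)]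
    field_simp

theorem summable_reflectingWeight : Summable (reflectingWeight p q) ↔
    Summable (fun n : ℕ => ∏ i ∈ Finset.Icc 1 (n + 1), q i / p i) :=
  (summable_nat_add_iff 2 (f := reflectingWeight p q)).symm

theorem cSeq_shift (n : ℕ) : cSeq (fun i => p (i + 1)) (fun i => q (i + 1)) n
    = ∏ i ∈ Finset.Icc 1 (n + 1), q i / p i := by
  rw [cSeq, Finset.range_eq_Ico, Finset.prod_Ico_add' (fun i => q i / p i) 0 (n + 1) 1]
  rfl

theorem not_summable_reflecting_of_le (hp : ∀ i, 0 < p i) {p' q' : ℝ} (h : p' ≤ q')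
    (hc : ∀ i, 1 ≤ i → p i = p' ∧ q i = q') :
    ¬ Summable (fun n : ℕ => ∏ i ∈ Finset.Icc 1 (n + 1), q i / p i) := by
  intro hs
  have h1 : ∀ n : ℕ, 1 ≤ ∏ i ∈ Finset.Icc 1 (n + 1), q i / p i := fun n =>
    Finset.one_le_prod fun i hi => by
      obtain ⟨h1, h2⟩ := hc i (Finset.mem_Icc.1 hi).1
      rw [one_le_div (hp i), h1, h2]
      exact h
  exact absurd (ge_of_tendsto' hs.tendsto_atTop_zero h1) (by norm_num)

theorem summable_reflecting_of_lt (hp : ∀ i, 0 < p i) (hq : ∀ i, 1 ≤ i → 0 < q i) {p' q' : ℝ}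
    (h : q' < p') (hc : ∀ i, 1 ≤ i → p i = p' ∧ q i = q') :
    Summable (fun n : ℕ => ∏ i ∈ Finset.Icc 1 (n + 1), q i / p i) := by
  obtain ⟨h1, h2⟩ := hc 1 le_rfl
  have hp' : 0 < p' := h1 ▸ hp 1
  have hq' : 0 < q' := h2 ▸ hq 1 le_rfl
  have hgeom : Summable fun n : ℕ => (q' / p') ^ (n + 1) :=
    (summable_nat_add_iff 1).2 (summable_geometric_of_lt_one (div_pos hq' hp').le
      ((div_lt_one hp').2 h))
  refine hgeom.congr fun n => ?_
  rw [Finset.prod_congr rfl fun i hi => by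
    rw [(hc i (Finset.mem_Icc.1 hi).1).1, (hc i (Finset.mem_Icc.1 hi).1).2]]
  simp [div_pow]

theorem not_summable_cSeq_of_le (hp : ∀ i, 0 < p i) (hq : ∀ i, 0 < q i) {p' q' : ℝ} (h : p' ≤ q')
    (hc : ∀ i, 1 ≤ i → p i = p' ∧ q i = q') : ¬ Summable (cSeq p q) := by
  intro hs
  have h1 : ∀ n : ℕ, q 0 / p 0 ≤ cSeq p q n := by
    intro n
    induction n with
    | zero => simp [cSeq]
    | succ n ih =>
      rw [cSeq_succ]
      refine ih.trans (le_mul_of_one_le_right ((div_pos (hq 0) (hp 0)).le.trans ih) ?_)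
      obtain ⟨h1, h2⟩ := hc (n + 1) (by lia)
      rw [one_le_div (hp _), h1, h2]
      exact h
  exact absurd (ge_of_tendsto' hs.tendsto_atTop_zero h1) (not_le.2 (div_pos (hq 0) (hp 0)))

theorem cSeq_of_const {p' q' : ℝ} (hc : ∀ i, p i = p' ∧ q i = q') (n : ℕ) :
    cSeq p q n = (q' / p') ^ (n + 1) := by
  simp [cSeq, hc, div_pow]

theorem scale_absorbingWeight (i : ℕ) :
    scale (absorbingWeight p q) i = 1 + ∑ n ∈ Finset.range i, cSeq p q n := by
  rw [scale_natCast, Finset.sum_range_succ', add_comm]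
  rfl

theorem ruin_absorbingWeight (hp : ∀ i, 0 < p i) (hq : ∀ i, 0 < q i) {i k : ℕ} (hik : i ≤ k) :
    ruin (absorbingWeight p q) k i
      = (∑ n ∈ Finset.Icc i k, cSeq p q n) / (1 + ∑ n ∈ Finset.range (k + 1), cSeq p q n) := by
  have h := scale_natCast_pos (absorbingWeight_pos hp hq) (k + 1)
  rw [scale_absorbingWeight] at h
  rw [ruin, min_eq_left (by exact_mod_cast hik.trans k.le_succ), scale_absorbingWeight,
    scale_absorbingWeight, eq_div_iff h.ne', sub_mul, div_mul_cancel₀ _ h.ne',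
    ← Finset.sum_range_add_sum_Ico (cSeq p q) (hik.trans k.le_succ)]
  rw [show Finset.Ico i (k + 1) = Finset.Icc i k from by ext; simp [Finset.mem_Icc]]
  ring

theorem sub_scale_absorbingWeight (hs : Summable (cSeq p q)) (hp : ∀ i, 0 < p i)
    (hq : ∀ i, 0 < q i) (i : ℕ) :
    1 - scale (absorbingWeight p q) i / ∑' n, absorbingWeight p q n
      = (∑' n : ℕ, cSeq p q (i + n)) / (1 + ∑' n : ℕ, cSeq p q n) := by
  have hs' := summable_absorbingWeight.2 hs
  have h1 : ∑' n, absorbingWeight p q n = 1 + ∑' n : ℕ, cSeq p q n := hs'.tsum_eq_zero_add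
  have hpos : 0 < 1 + ∑' n : ℕ, cSeq p q n := by
    rw [← h1]
    exact hs'.tsum_pos (fun n => (absorbingWeight_pos hp hq n).le) 0 (absorbingWeight_pos hp hq 0)
  rw [h1, scale_absorbingWeight, eq_div_iff hpos.ne', sub_mul, div_mul_cancel₀ _ hpos.ne',
    ← hs.sum_add_tsum_nat_add i]
  simp only [add_comm i]
  ring

end Weights

/-- Seen from the state `1`, a birth-death chain stopped at `0` is a chain absorbed at `-1`. -/
theorem IsMarkovChain.stopped_sub_one {Ω : Type*} [MeasurableSpace Ω] {P : Measure Ω}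
    {ν : ℤ → ℝ} {p q : ℕ → ℝ} {Y : ℕ → Ω → ℤ} (hY : IsMarkovChain P ν (transition p q) Y) :
    IsMarkovChain P (fun x => ν (x + 1)) (transition (fun i => p (i + 1)) fun i => q (i + 1))
      fun n ω => RandomUHF.stopped {0} Y n ω - 1 := by
  have hX := hY.stopped {0}
  have hT : ∀ x j, absorbingOn {0} (transition p q) (x + 1) (j + 1)
      = transition (fun i => p (i + 1)) (fun i => q (i + 1)) x j := by
    intro x j
    rcases lt_or_ge x 0 with hx | hx
    · rw [transition_of_neg hx]
      by_cases h0 : x + 1 = 0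
      · simp [absorbingOn, show x = -1 by lia, show j + 1 = 0 ↔ j = -1 by lia]
      · simp [absorbingOn, h0, transition_of_neg (show x + 1 < 0 by lia)]
    · lift x to ℕ using hx
      have h0 : ((x : ℤ) + 1) ∉ ({0} : Set ℤ) := by simp; lia
      simp only [absorbingOn, h0, if_false]
      rw [show ((x : ℤ) + 1) = ((x + 1 : ℕ) : ℤ) by push_cast; rfl, transition_natCast,
        transition_natCast]
      have e1 : (j + 1 = ((x + 1 : ℕ) : ℤ) + 1) ↔ j = (x : ℤ) + 1 := by lia
      have e2 : (j + 1 = ((x + 1 : ℕ) : ℤ) - 1) ↔ j = (x : ℤ) - 1 := by lia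
      simp only [e1, e2]
  refine ⟨fun n => (hX.measurable n).sub_const 1, fun x => ?_, fun n x j => ?_⟩
  · simpa only [sub_eq_iff_eq_add] using hX.initial (x + 1)
  · simpa only [sub_eq_iff_eq_add, hT] using hX.step n (fun i => x i + 1) (j + 1)

section Chain

variable {Ω : Type*} [MeasurableSpace Ω] {P : Measure Ω} [IsProbabilityMeasure P]
  {ν : ℤ → ℝ} {p q π : ℕ → ℝ} {Y : ℕ → Ω → ℤ}

/-- If the scale function is unbounded, the ruin probabilities tend to one. -/
theorem ae_absorbed_of_not_summable (hp : ∀ i, 0 < p i) (hq : ∀ i, 0 < q i)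
    (hpq : ∀ i, p i + q i = 1) (hY : IsMarkovChain P ν (transition p q) Y)
    (hs : ¬ Summable (cSeq p q)) : ∀ᵐ ω ∂P, ∃ n, Y n ω < 0 := by
  have h := measureReal_absorbed hpq hY (absorbingWeight_pos hp hq)
    (absorbingWeight_harmonic hp)
    (tendsto_ruin_of_not_summable (absorbingWeight_pos hp hq)
      (mt summable_absorbingWeight.1 hs))
  have hm : MeasurableSet {ω | ∃ n, Y n ω < 0} := by
    simp only [Set.ofPred_exists]
    exact MeasurableSet.iUnion fun n => hY.measurable n measurableSet_Iio
  have h1 : P {ω | ∃ n, Y n ω < 0} = 1 := by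
    rw [integral_const, smul_eq_mul, mul_one, probReal_univ] at h
    rwa [measureReal_def, ENNReal.toReal_eq_one_iff] at h
  exact (prob_compl_eq_zero_iff hm).2 h1

/-- A chain for which the scale function is unbounded reaches `0`, since the chain stopped there,
moved down by one state, is almost surely absorbed at `-1`. -/
theorem ae_exists_le_zero (hp : ∀ i, 0 < p i) (hq : ∀ i, 1 ≤ i → 0 < q i)
    (hpq : ∀ i, p i + q i = 1) (hY : IsMarkovChain P ν (transition p q) Y)
    (hs : ¬ Summable (fun n : ℕ => ∏ i ∈ Finset.Icc 1 (n + 1), q i / p i)) :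
    ∀ᵐ ω ∂P, ∃ n, Y n ω ≤ 0 := by
  have h := ae_absorbed_of_not_summable (fun i => hp (i + 1)) (fun i => hq (i + 1) (by lia))
    (fun i => hpq (i + 1)) hY.stopped_sub_one (by simpa only [funext cSeq_shift] using hs)
  filter_upwards [h] with ω ⟨n, hn⟩
  obtain ⟨i, -, hi⟩ := exists_eq_stopped (Y := Y) {0} n ω
  exact ⟨i, by lia⟩

theorem IsMarkovChain.ae_nonneg (hq₀ : q 0 = 0) (hY : IsMarkovChain P ν (transition p q) Y)
    (h0 : ∀ᵐ ω ∂P, 0 ≤ Y 0 ω) : ∀ᵐ ω ∂P, ∀ n, 0 ≤ Y n ω := by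
  filter_upwards [h0, hY.ae_step] with ω hω hstep n
  induction n with
  | zero => exact hω
  | succ n ih =>
    rcases hstep n with h | ⟨-, h | ⟨h, hne⟩⟩
    · lia
    · lia
    · have : Y n ω ≠ 0 := fun h0 => hne (by rw [h0]; exact hq₀)
      lia

/-- A chain on `{0, 1, 2, …}` for which the scale function is unbounded visits every state
infinitely often: from any time on it comes back to `0`, and from there it has to climb through all
states below any given bound, since it leaves bounded intervals. -/
theorem ae_frequently_eq (hp : ∀ i, 0 < p i) (hq₀ : q 0 = 0) (hq : ∀ i, 1 ≤ i → 0 < q i)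
    (hpq : ∀ i, p i + q i = 1) (hY : IsMarkovChain P ν (transition p q) Y)
    (h0 : ∀ᵐ ω ∂P, 0 ≤ Y 0 ω)
    (hs : ¬ Summable (fun n : ℕ => ∏ i ∈ Finset.Icc 1 (n + 1), q i / p i)) :
    ∀ᵐ ω ∂P, ∀ j : ℕ, ∃ᶠ n in atTop, Y n ω = j := by
  have h1 : ∀ᵐ ω ∂P, ∀ N, ∃ n, Y (n + N) ω ≤ 0 :=
    ae_all_iff.2 fun N => ae_exists_le_zero hp hq hpq (hY.shift N) hs
  have h2 : ∀ᵐ ω ∂P, ∀ (N b : ℕ), ∃ n, Y (n + N) ω < 0 ∨ (b : ℤ) ≤ Y (n + N) ω :=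
    ae_all_iff.2 fun N => ae_all_iff.2 fun b => ae_exists_exit hpq (hY.shift N)
      (reflectingWeight_pos hp hq) (reflectingWeight_subharmonic hp hq₀) b
  filter_upwards [h1, h2, hY.ae_nonneg hq₀ h0, hY.ae_step] with ω h1 h2 hnn hstep j
  rw [frequently_atTop]
  intro N
  obtain ⟨a, ha⟩ := h1 N
  obtain ⟨n, hn⟩ := h2 (a + N) j
  have hn : (j : ℤ) ≤ Y (n + (a + N)) ω := hn.resolve_left (not_lt.2 (hnn _))
  -- If the chain avoided `j` from now on, it would stay below `j`, since it moves by single steps.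
  by_contra! hne
  have hlt : ∀ m, Y (m + (a + N)) ω < j := by
    intro m
    induction m with
    | zero =>
      refine lt_of_le_of_ne ?_ (hne _ (by lia))
      rw [zero_add]
      exact ha.trans (by lia)
    | succ m ih =>
      refine lt_of_le_of_ne ?_ (hne _ (by lia))
      rw [Nat.add_right_comm]
      rcases hstep (m + (a + N)) with h | ⟨-, h | ⟨h, -⟩⟩ <;> lia
  exact absurd (hlt n) (not_lt.2 hn)

/-- Up to null sets, the chain is absorbed if and only if it visits `{1, 2, …}` finitely often: it
cannot stay at `0`. -/
theorem ae_absorbed_iff (hY : IsMarkovChain P ν (transition p q) Y) :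
    ∀ᵐ ω ∂P, (∃ n, Y n ω < 0) ↔ ∀ᶠ n in atTop, Y n ω ≤ 0 := by
  filter_upwards [hY.ae_step] with ω hstep
  constructor
  · rintro ⟨n, hn⟩
    filter_upwards [eventually_ge_atTop n] with m hm
    rw [eq_of_neg (y := fun n => Y n ω) (fun i hi => by
      rcases hstep i with h | h
      · exact h.2
      · lia) hn hm]
    exact hn.le
  · intro h
    obtain ⟨n, hn⟩ := eventually_atTop.1 h
    by_contra! hnn
    have h1 := hn n le_rfl
    have h2 := hn (n + 1) (by lia)
    rcases hstep n with h | ⟨-, h | ⟨h, -⟩⟩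
    · have := hnn n; lia
    · have := hnn n; lia
    · have := hnn n; have := hnn (n + 1); lia

theorem measureReal_ruin_eq (hp : ∀ i, 0 < p i) (hq : ∀ i, 0 < q i)
    (hpq : ∀ i, p i + q i = 1) (hY : IsMarkovChain P (initialDist π) (transition p q) Y) (k : ℕ) :
    P.real {ω | (∃ n, Y n ω < 0) ∧ ∀ n, Y n ω ≤ k} =
      (∑ i ∈ Finset.range (k + 1), π i * ∑ n ∈ Finset.Icc i k, cSeq p q n) /
        (1 + ∑ n ∈ Finset.range (k + 1), cSeq p q n) := by
  have hw := absorbingWeight_pos hp hq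
  rw [measureReal_ruin hpq hY hw (absorbingWeight_harmonic hp)]
  have h := hasSum_sum_of_ne_finset_zero (L := SummationFilter.unconditional ℕ)
    (f := fun i : ℕ => π i * ruin (absorbingWeight p q) k i)
    (s := Finset.range (k + 1)) (fun i hi => by
      rw [ruin_of_le hw k (by simpa using hi), mul_zero])
  rw [(hY.hasSum_initial (abs_ruin_le hw k)).unique h, Finset.sum_div]
  refine Finset.sum_congr rfl fun i hi => ?_
  rw [ruin_absorbingWeight hp hq (Nat.le_of_lt_succ (Finset.mem_range.1 hi)), mul_div_assoc]

theorem hasSum_absorbed (hp : ∀ i, 0 < p i) (hq : ∀ i, 0 < q i)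
    (hpq : ∀ i, p i + q i = 1) (hY : IsMarkovChain P (initialDist π) (transition p q) Y)
    (hs : Summable (cSeq p q)) :
    HasSum (fun i : ℕ => π i * ((∑' n : ℕ, cSeq p q (i + n)) / (1 + ∑' n : ℕ, cSeq p q n)))
      (P.real {ω | ∃ n, Y n ω < 0}) := by
  have hw := absorbingWeight_pos hp hq
  have hs' := summable_absorbingWeight.2 hs
  have hlim := tendsto_ruin_of_summable hw hs'
  rw [measureReal_absorbed hpq hY hw (absorbingWeight_harmonic hp) hlim]
  simp only [← sub_scale_absorbingWeight hs hp hq]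
  exact hY.hasSum_initial (g := fun x => 1 - scale (absorbingWeight p q) x /
    ∑' n, absorbingWeight p q n) fun x =>
      le_of_tendsto' (hlim x).abs fun k => abs_ruin_le hw k x

end Chain

end RandomUHF

/-! ### Operators on finitely many tensor factors -/

namespace RandomUHF

section Index

variable {d : ℕ → ℕ}

theorem TensorIndex.ext' {x y : TensorIndex d} (h : ∀ n, x.1 n = y.1 n) : x = y :=
  Subtype.ext (Finsupp.ext h)

theorem TensorIndex.set_apply (x : TensorIndex d) (n : ℕ) (j : Fin (d n)) (k : ℕ) :
    (x.set n j).1 k = if k = n then (j : ℕ) else x.1 k := by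
  classical
  rw [TensorIndex.set, Finsupp.update_apply]

/-- The `n`-th coordinate of a basis index. -/
def TensorIndex.coord (x : TensorIndex d) (n : ℕ) : Fin (d n) := ⟨x.1 n, x.2 n⟩

/-- The index with the coordinates of `x` inside `F` and those of `y` outside `F`. -/
noncomputable def TensorIndex.piecewise (F : Finset ℕ) (x y : TensorIndex d) : TensorIndex d :=
  ⟨Finsupp.onFinset (x.1.support ∪ y.1.support) (fun n => if n ∈ F then x.1 n else y.1 n)
    (fun n hn => by
      by_contra! h
      simp only [Finset.mem_union, Finsupp.mem_support_iff, not_or, not_not] at h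
      simp [h] at hn), fun n => by
    simp only [Finsupp.onFinset_apply]
    split_ifs
    · exact x.2 n
    · exact y.2 n⟩

theorem TensorIndex.piecewise_apply (F : Finset ℕ) (x y : TensorIndex d) (n : ℕ) :
    (x.piecewise F y).1 n = if n ∈ F then x.1 n else y.1 n := rfl

/-- The index that is `v` on `F` and zero elsewhere. -/
noncomputable def TensorIndex.extend (hd : ∀ n, 0 < d n) (F : Finset ℕ)
    (v : ∀ n : F, Fin (d n)) : TensorIndex d :=
  ⟨Finsupp.onFinset F (fun n => if h : n ∈ F then (v ⟨n, h⟩ : ℕ) else 0)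
    (fun n hn => by by_contra h; simp [h] at hn), fun n => by
    simp only [Finsupp.onFinset_apply]
    split_ifs with h
    · exact (v ⟨n, h⟩).2
    · exact hd n⟩

theorem TensorIndex.extend_apply_mem (hd : ∀ n, 0 < d n) {F : Finset ℕ} (v : ∀ n : F, Fin (d n))
    {n : ℕ} (h : n ∈ F) : (TensorIndex.extend hd F v).1 n = v ⟨n, h⟩ := dif_pos h

theorem TensorIndex.extend_apply_notMem (hd : ∀ n, 0 < d n) {F : Finset ℕ}
    (v : ∀ n : F, Fin (d n)) {n : ℕ} (h : n ∉ F) : (TensorIndex.extend hd F v).1 n = 0 := dif_neg h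

/-- The indices supported in `F` are the basis indices of the finite tensor product over `F`. -/
noncomputable def TensorIndex.supportedEquiv (hd : ∀ n, 0 < d n) (F : Finset ℕ) :
    {x : TensorIndex d // ∀ n ∉ F, x.1 n = 0} ≃ (∀ n : F, Fin (d n)) where
  toFun x n := x.1.coord n
  invFun v := ⟨TensorIndex.extend hd F v, fun _ h => TensorIndex.extend_apply_notMem hd v h⟩
  left_inv x := by
    refine Subtype.ext (TensorIndex.ext' fun n => ?_)
    by_cases h : n ∈ F
    · rw [TensorIndex.extend_apply_mem hd _ h]; rfl
    · rw [TensorIndex.extend_apply_notMem hd _ h, x.2 n h]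
  right_inv v := by
    funext n
    exact Fin.ext (TensorIndex.extend_apply_mem hd v n.2)

theorem TensorIndex.card_supported (hd : ∀ n, 0 < d n) (F : Finset ℕ) :
    Nat.card {x : TensorIndex d // ∀ n ∉ F, x.1 n = 0} = ∏ n ∈ F, d n := by
  rw [Nat.card_congr (TensorIndex.supportedEquiv hd F), Nat.card_eq_fintype_card, Fintype.card_pi]
  simp only [Fintype.card_fin]
  exact Finset.prod_coe_sort F d

end Index

section Operators

variable {d : ℕ → ℕ}

/-- The canonical matrix units of all the tensor factors. -/
abbrev matrixUnits (d : ℕ → ℕ) : Set (TensorSpace d →L[ℂ] TensorSpace d) :=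
  {T | ∃ (n : ℕ) (i j : Fin (d n)), T = matrixUnit n i j}

theorem matrixUnit_apply (n : ℕ) (i j : Fin (d n)) (f : TensorSpace d) (y : TensorIndex d) :
    matrixUnit n i j f y = if y.1 n = i then f (y.set n j) else 0 := rfl

theorem matrixUnit_mem_adjoin (n : ℕ) (i j : Fin (d n)) :
    matrixUnit n i j ∈ StarAlgebra.adjoin ℂ (matrixUnits d) :=
  StarAlgebra.subset_adjoin ℂ _ ⟨n, i, j, rfl⟩

theorem adjoin_le_uhfSubalgebra : StarAlgebra.adjoin ℂ (matrixUnits d) ≤ uhfSubalgebra d :=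
  StarSubalgebra.le_topologicalClosure _

/-- The canonical basis vector `e_{x 0} ⊗ e_{x 1} ⊗ ⋯`. -/
noncomputable def basisVec (x : TensorIndex d) : TensorSpace d := lp.single 2 x 1

theorem basisVec_apply (x y : TensorIndex d) : basisVec x y = if y = x then 1 else 0 := by
  rw [basisVec, lp.single_apply, Pi.single_apply]

/-- The coefficient of a vector at a canonical basis vector. -/
noncomputable def coeff (x : TensorIndex d) : TensorSpace d →ₗ[ℂ] ℂ :=
  lp.evalₗ (fun _ => ℂ) 2 x

theorem coeff_apply (x : TensorIndex d) (f : TensorSpace d) : coeff x f = f x := rfl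

/-- The algebra generated by the tensor factors contains the matrix units
`e_{x x'} = ⨂_{n ∈ F} e_{x n, x' n}` of every finite tensor product. -/
theorem exists_mem_adjoin_eq_matrixUnit (F : Finset ℕ) (x x' : TensorIndex d) :
    ∃ E ∈ StarAlgebra.adjoin ℂ (matrixUnits d), ∀ (f : TensorSpace d) (z : TensorIndex d),
      E f z = if ∀ n ∈ F, z.1 n = x.1 n then f (x'.piecewise F z) else 0 := by
  induction F using Finset.induction_on with
  | empty =>
    refine ⟨1, one_mem _, fun f z => ?_⟩
    have : x'.piecewise ∅ z = z := TensorIndex.ext' fun n => by simp [TensorIndex.piecewise_apply]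
    simp [this]
  | insert n F hn ih =>
    obtain ⟨E, hE, hEf⟩ := ih
    refine ⟨matrixUnit n (x.coord n) (x'.coord n) * E, mul_mem (matrixUnit_mem_adjoin _ _ _) hE,
      fun f z => ?_⟩
    rw [mul_apply_eq_comp, matrixUnit_apply, hEf]
    have h1 : (∀ k ∈ F, (z.set n (x'.coord n)).1 k = x.1 k) ↔ ∀ k ∈ F, z.1 k = x.1 k := by
      refine forall₂_congr fun k hk => ?_
      rw [TensorIndex.set_apply, if_neg (fun h : k = n => hn (h ▸ hk))]
    have h2 : x'.piecewise F (z.set n (x'.coord n)) = x'.piecewise (insert n F) z := by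
      refine TensorIndex.ext' fun k => ?_
      simp only [TensorIndex.piecewise_apply, TensorIndex.set_apply, Finset.mem_insert]
      by_cases hkn : k = n
      · subst hkn; simp [hn, TensorIndex.coord]
      · simp [hkn]
    simp only [h1, h2, Finset.forall_mem_insert, ite_and]
    rfl

/-- The corner matrix units of the nontrivial factors are linearly independent: changing one
coordinate of a basis vector from `0` to `1` affects the corner unit of this factor only. -/
theorem finite_of_finiteDimensional (hd : ∀ n, 0 < d n) [FiniteDimensional ℂ (UHF d)] :
    {n | d n ≠ 1}.Finite := by
  set S := {n | d n ≠ 1}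
  let u : S → UHF d := fun n => ⟨matrixUnit (n : ℕ) ⟨0, hd n⟩ ⟨0, hd n⟩,
    adjoin_le_uhfSubalgebra (matrixUnit_mem_adjoin _ _ _)⟩
  let z : TensorIndex d := ⟨0, fun n => by simpa using hd n⟩
  have hS : ∀ k : S, 1 < d k := fun k => by
    have h1 := hd k
    have h2 : d k ≠ 1 := k.2
    lia
  have hli : LinearIndependent ℂ u := by
    rw [linearIndependent_iff']
    intro s g hg k hk
    have hcoef : ∀ x : TensorIndex d, ∑ n ∈ s, g n * (if x.1 n = 0 then 1 else 0) = 0 := by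
      intro x
      have h1 := congrArg (fun T : UHF d => coeff x (T.1 (basisVec x))) hg
      simp only [AddSubmonoidClass.coe_finsetSum, SetLike.val_smul, ZeroMemClass.coe_zero,
        sum_apply, smul_apply, zero_apply, map_sum, map_smul, map_zero, smul_eq_mul,
        coeff_apply] at h1
      refine Eq.trans (Finset.sum_congr rfl fun n _ => ?_) h1
      simp only [u, matrixUnit_apply]
      by_cases hx : x.1 n = 0
      · have : x.set n ⟨0, hd n⟩ = x := TensorIndex.ext' fun k => by
          rw [TensorIndex.set_apply]
          split_ifs with h
          · rw [h, hx]
          · rfl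
        simp [hx, this, basisVec_apply]
      · simp [hx]
    have h0 := hcoef z
    have h1 := hcoef (z.set k ⟨1, hS k⟩)
    rw [← Finset.add_sum_erase s _ hk] at h0 h1
    have h2 : ∑ n ∈ s.erase k, g n * (if (z.set k ⟨1, hS k⟩).1 n = 0 then 1 else 0)
        = ∑ n ∈ s.erase k, g n * (if z.1 n = 0 then 1 else 0) := by
      refine Finset.sum_congr rfl fun n hn => ?_
      have : (n : ℕ) ≠ k := fun h => (Finset.mem_erase.1 hn).1 (Subtype.ext h)
      rw [TensorIndex.set_apply, if_neg this]
    rw [h2] at h1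
    have h3 := h0.trans h1.symm
    simpa [TensorIndex.set_apply, z] using h3
  have := hli.finite
  exact Set.toFinite S

/-- In finite dimensions every operator is a linear combination of the matrix units of the finite
tensor product of the nontrivial factors. -/
theorem uhfSubalgebra_eq_top [Fintype (TensorIndex d)] (hS : {n | d n ≠ 1}.Finite) :
    uhfSubalgebra d = ⊤ := by
  classical
  refine eq_top_iff.2 fun T _ => ?_
  have h0 : ∀ (x : TensorIndex d) n, n ∉ hS.toFinset → x.1 n = 0 := fun x n hn => by
    have h1 : d n = 1 := by simpa using hn
    have h2 := x.2 n
    lia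
  choose E hE hEf using exists_mem_adjoin_eq_matrixUnit (d := d) hS.toFinset
  have hT : T = ∑ x, ∑ y, (T (basisVec y) x) • E x y := by
    refine ContinuousLinearMap.ext fun f => ?_
    have hf : f = ∑ y, f y • basisVec y := by
      refine lp.ext (funext fun z => ?_)
      simp only [lp.coeFn_sum, Finset.sum_apply, lp.coeFn_smul, Pi.smul_apply, smul_eq_mul,
        basisVec_apply]
      simp
    refine lp.ext (funext fun z => ?_)
    have hEz : ∀ x y, E x y f z = if z = x then f y else 0 := by
      intro x y
      rw [hEf]
      have h1 : (∀ n ∈ hS.toFinset, z.1 n = x.1 n) ↔ z = x := by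
        constructor
        · intro h
          refine TensorIndex.ext' fun n => ?_
          by_cases hn : n ∈ hS.toFinset
          · exact h n hn
          · rw [h0 z n hn, h0 x n hn]
        · rintro rfl n _; rfl
      have h2 : y.piecewise hS.toFinset z = y := TensorIndex.ext' fun n => by
        rw [TensorIndex.piecewise_apply]
        split_ifs with hn
        · rfl
        · rw [h0 z n hn, h0 y n hn]
      simp only [h1, h2]
    simp only [← coeff_apply] at hEz ⊢
    simp only [sum_apply, smul_apply, map_sum, map_smul, smul_eq_mul, hEz]
    rw [Finset.sum_eq_single_of_mem z (Finset.mem_univ z) fun x _ hx => by simp [hx.symm]]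
    conv_lhs => rw [hf]
    simp only [map_sum, map_smul, smul_eq_mul, if_true, coeff_apply, mul_comm]
  rw [hT]
  exact sum_mem fun x _ => sum_mem fun y _ =>
    (uhfSubalgebra d).smul_mem (adjoin_le_uhfSubalgebra (hE x y)) _

/-- If only finitely many factors are nontrivial, the tensor product is a full matrix algebra. -/
theorem nonempty_starAlgEquiv_matrix (hd : ∀ n, 0 < d n) (hS : {n | d n ≠ 1}.Finite) :
    Nonempty (UHF d ≃⋆ₐ[ℂ]
      Matrix (Fin (∏ n ∈ hS.toFinset, d n)) (Fin (∏ n ∈ hS.toFinset, d n)) ℂ) := by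
  have h0 : ∀ (x : TensorIndex d) n, n ∉ hS.toFinset → x.1 n = 0 := fun x n hn => by
    have h1 : d n = 1 := by simpa using hn
    have h2 := x.2 n
    lia
  let e1 := TensorIndex.supportedEquiv hd hS.toFinset
  let e0 : TensorIndex d ≃ {x : TensorIndex d // ∀ n ∉ hS.toFinset, x.1 n = 0} :=
    (Equiv.subtypeUnivEquiv h0).symm
  let _ : Fintype (TensorIndex d) := Fintype.ofEquiv _ (e0.trans e1).symm
  have hcard : Fintype.card (TensorIndex d) = ∏ n ∈ hS.toFinset, d n := by
    rw [← TensorIndex.card_supported hd, ← Nat.card_congr e0, Nat.card_eq_fintype_card]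
  let U : TensorSpace d ≃ₗᵢ[ℂ] EuclideanSpace ℂ (Fin (∏ n ∈ hS.toFinset, d n)) :=
    (lpPiLpₗᵢ (fun _ : TensorIndex d => ℂ) ℂ).trans
      (LinearIsometryEquiv.piLpCongrLeft 2 ℂ ℂ (Fintype.equivFinOfCardEq hcard))
  have htop := uhfSubalgebra_eq_top hS
  refine ⟨StarAlgEquiv.trans ?_ (U.conjStarAlgEquiv.trans Matrix.toEuclideanCLM.symm)⟩
  refine StarAlgEquiv.ofBijective (uhfSubalgebra d).subtype
    ⟨Subtype.val_injective, fun T => ⟨⟨T, by rw [htop]; trivial⟩, rfl⟩⟩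

theorem finiteDimensional_iff (hd : ∀ n, 0 < d n) :
    FiniteDimensional ℂ (UHF d) ↔ {n | d n ≠ 1}.Finite := by
  refine ⟨fun h => finite_of_finiteDimensional hd, fun hS => ?_⟩
  obtain ⟨Φ⟩ := nonempty_starAlgEquiv_matrix hd hS
  exact Module.Finite.equiv Φ.toAlgEquiv.toLinearEquiv.symm

theorem isMatrixAlgebraWith_iff (hd : ∀ n, 0 < d n) (C : ℕ → Prop) :
    IsMatrixAlgebraWith C (UHF d) ↔
      {n | d n ≠ 1}.Finite ∧ ∀ n r : ℕ, r.Prime → r ∣ d n → C r := by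
  constructor
  · rintro ⟨N, ⟨Φ⟩, hN⟩
    have hfd : FiniteDimensional ℂ (UHF d) := Module.Finite.equiv Φ.toAlgEquiv.toLinearEquiv.symm
    have hS := finite_of_finiteDimensional hd
    refine ⟨hS, fun n r hr hrn => hN r hr ?_⟩
    obtain ⟨Ψ⟩ := nonempty_starAlgEquiv_matrix hd hS
    -- `N` is the product of the factors, because both matrix algebras have the same dimension.
    have hrank := (Ψ.symm.trans Φ).toAlgEquiv.toLinearEquiv.finrank_eq
    simp only [Module.finrank_matrix, Module.finrank_self, Fintype.card_fin,
      mul_one] at hrank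
    have hNS : ∏ n ∈ hS.toFinset, d n = N := by
      simpa [← sq] using hrank
    rw [← hNS]
    refine hrn.trans (Finset.dvd_prod_of_mem d ?_)
    rw [Set.Finite.mem_toFinset]
    intro h1
    rw [h1] at hrn
    exact hr.one_lt.ne' (Nat.dvd_one.1 hrn)
  · rintro ⟨hS, hC⟩
    refine ⟨_, nonempty_starAlgEquiv_matrix hd hS, fun r hr hrN => ?_⟩
    obtain ⟨n, -, hn⟩ := (Nat.Prime.prime hr).exists_mem_finset_dvd hrN
    exact hC n r hr hn

end Operators

end RandomUHF

/-! ### Regrouping of tensor factors -/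

namespace RandomUHF

section Unitary

theorem memℓp_comp_equiv {α β : Type*} (e : α ≃ β) (f : lp (fun _ : β => ℂ) 2) :
    Memℓp (fun a => f (e a)) 2 := by
  have h := (lp.memℓp f).summable (by simp)
  have h1 : Summable fun a => ‖f (e a)‖ ^ (2 : ENNReal).toReal := h.comp_injective e.injective
  exact memℓp_gen h1

/-- The unitary between `ℓ²` spaces that permutes the canonical basis vectors. -/
noncomputable def lpReindex {α β : Type*} (e : α ≃ β) :
    lp (fun _ : α => ℂ) 2 ≃ₗᵢ[ℂ] lp (fun _ : β => ℂ) 2 where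
  toFun f := ⟨fun b => f (e.symm b), memℓp_comp_equiv e.symm f⟩
  invFun f := ⟨fun a => f (e a), memℓp_comp_equiv e f⟩
  map_add' _ _ := rfl
  map_smul' _ _ := rfl
  left_inv f := lp.ext (funext fun a => congrArg f (e.symm_apply_apply a))
  right_inv f := lp.ext (funext fun b => congrArg f (e.apply_symm_apply b))
  norm_map' f := by
    rw [lp.norm_eq_tsum_rpow (by simp), lp.norm_eq_tsum_rpow (by simp)]
    congr 1
    exact e.symm.tsum_eq fun a => ‖f a‖ ^ (2 : ENNReal).toReal

variable {d d' : ℕ → ℕ}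

/-- A continuous homomorphism of the ambient operator algebras restricts to the tensor products as
soon as it does so on the matrix units. -/
theorem map_mem_uhfSubalgebra
    (Φ : (TensorSpace d →L[ℂ] TensorSpace d) →⋆ₐ[ℂ] (TensorSpace d' →L[ℂ] TensorSpace d'))
    (hΦ : Continuous Φ) (h : ∀ n i j, Φ (matrixUnit n i j) ∈ uhfSubalgebra d')
    {T : TensorSpace d →L[ℂ] TensorSpace d} (hT : T ∈ uhfSubalgebra d) :
    Φ T ∈ uhfSubalgebra d' := by
  have hle : uhfSubalgebra d ≤ (uhfSubalgebra d').comap Φ := by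
    refine StarSubalgebra.topologicalClosure_minimal (StarAlgebra.adjoin_le ?_) ?_
    · rintro _ ⟨n, i, j, rfl⟩
      exact h n i j
    · exact (StarSubalgebra.isClosed_topologicalClosure _).preimage hΦ
  exact hle hT

/-- A unitary that conjugates the matrix units of either tensor product into the other one induces
an isomorphism. -/
theorem nonempty_uhf_equiv_of_unitary (U : TensorSpace d ≃ₗᵢ[ℂ] TensorSpace d')
    (h : ∀ n i j, U.conjStarAlgEquiv (matrixUnit n i j) ∈ uhfSubalgebra d')
    (h' : ∀ n i j, U.symm.conjStarAlgEquiv (matrixUnit n i j) ∈ uhfSubalgebra d) :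
    Nonempty (UHF d ≃⋆ₐ[ℂ] UHF d') := by
  have hc : Continuous U.conjStarAlgEquiv :=
    U.toContinuousLinearEquiv.conjContinuousAlgEquiv.continuous
  have hc' : Continuous U.symm.conjStarAlgEquiv :=
    U.symm.toContinuousLinearEquiv.conjContinuousAlgEquiv.continuous
  have hm : ∀ T ∈ uhfSubalgebra d, U.conjStarAlgEquiv T ∈ uhfSubalgebra d' := fun T hT =>
    map_mem_uhfSubalgebra U.conjStarAlgEquiv.toStarAlgHom hc h hT
  have hm' : ∀ T ∈ uhfSubalgebra d', U.symm.conjStarAlgEquiv T ∈ uhfSubalgebra d := fun T hT =>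
    map_mem_uhfSubalgebra U.symm.conjStarAlgEquiv.toStarAlgHom hc' h' hT
  refine ⟨StarAlgEquiv.ofBijective ((U.conjStarAlgEquiv.toStarAlgHom.comp
    (uhfSubalgebra d).subtype).codRestrict (uhfSubalgebra d') fun T => hm T T.2) ⟨?_, ?_⟩⟩
  · intro S T hST
    exact Subtype.ext (U.conjStarAlgEquiv.injective (congrArg Subtype.val hST))
  · intro T
    refine ⟨⟨_, hm' T T.2⟩, Subtype.ext ?_⟩
    have h := U.conjStarAlgEquiv.apply_symm_apply T.1
    rw [LinearIsometryEquiv.symm_conjStarAlgEquiv] at h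
    exact h

end Unitary

section Grouping

variable {d d' : ℕ → ℕ}

/-- The coordinates of an index inside `F`. -/
def TensorIndex.restrict (F : Finset ℕ) (x : TensorIndex d) : ∀ n : F, Fin (d n) :=
  fun n => x.coord n

theorem coord_eq_zero_iff {k : ℕ} (hk : 0 < k) (a : Fin k) : (a : ℕ) = 0 ↔ a = ⟨0, hk⟩ := by
  rw [Fin.ext_iff]

/-- A regrouping of the tensor factors `d n` into blocks `F m` whose products are the factors
`d' m`. Since the Hilbert spaces are tensor products relative to the reference vectors `e₀`, the
identification of the basis indices has to preserve the index zero; otherwise it would not respect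
finite supports. -/
structure Grouping (d d' : ℕ → ℕ) where
  /-- All factors are nonzero. -/
  pos : ∀ n, 0 < d n
  /-- All new factors are nonzero. -/
  pos' : ∀ m, 0 < d' m
  /-- The blocks. -/
  F : ℕ → Finset ℕ
  /-- The number of the block of an index; the value is arbitrary outside the blocks. -/
  g : ℕ → ℕ
  /-- The blocks are disjoint, since `g` tells them apart. -/
  g_eq : ∀ m, ∀ n ∈ F m, g n = m
  /-- Factors outside the blocks are trivial. -/
  trivial_of_notMem : ∀ n, n ∉ F (g n) → d n = 1
  /-- The identification of the basis indices. -/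
  b : ∀ m, (∀ n : F m, Fin (d n)) ≃ Fin (d' m)
  /-- The reference vectors correspond to each other. -/
  b_zero : ∀ m, b m (fun n => ⟨0, pos n⟩) = ⟨0, pos' m⟩

namespace Grouping

variable (G : Grouping d d')

theorem b_symm_zero (m : ℕ) : (G.b m).symm ⟨0, G.pos' m⟩ = fun n => ⟨0, G.pos n⟩ := by
  rw [Equiv.symm_apply_eq, G.b_zero]

/-- The bijection between the basis indices of the two tensor products. -/
noncomputable def indexEquiv : TensorIndex d ≃ TensorIndex d' where
  toFun x := ⟨Finsupp.onFinset (x.1.support.image G.g) (fun m => G.b m (x.restrict (G.F m)))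
    (fun m hm => by
      by_contra hnot
      refine hm ((coord_eq_zero_iff (G.pos' m) _).2 ?_)
      rw [← G.b_zero m]
      congr 1
      funext n
      refine Fin.ext ?_
      by_contra hne
      exact hnot (Finset.mem_image.2 ⟨n, Finsupp.mem_support_iff.2 hne, G.g_eq m n n.2⟩)),
    fun m => (G.b m _).2⟩
  invFun w := ⟨Finsupp.onFinset (w.1.support.biUnion G.F)
    (fun n => if h : n ∈ G.F (G.g n) then (G.b (G.g n)).symm (w.coord (G.g n)) ⟨n, h⟩ else 0)
    (fun n hn => by
      by_contra hnot
      by_cases h : n ∈ G.F (G.g n)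
      · have h0 : w.coord (G.g n) = ⟨0, G.pos' _⟩ := by
          refine Fin.ext ?_
          by_contra hne
          exact hnot (Finset.mem_biUnion.2 ⟨G.g n, Finsupp.mem_support_iff.2 hne, h⟩)
        simp [h, h0, b_symm_zero] at hn
      · simp [h] at hn), fun n => by
    simp only [Finsupp.onFinset_apply]
    split_ifs with h
    · exact Fin.is_lt _
    · exact G.pos n⟩
  left_inv x := by
    refine TensorIndex.ext' fun n => ?_
    simp only [Finsupp.onFinset_apply]
    split_ifs with h
    · have : ∀ y : TensorIndex d', y.coord (G.g n) = G.b _ (x.restrict (G.F (G.g n))) →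
          ((G.b (G.g n)).symm (y.coord (G.g n)) ⟨n, h⟩ : ℕ) = x.1 n := by
        intro y hy
        rw [hy, Equiv.symm_apply_apply]
        rfl
      exact this _ rfl
    · have h1 := G.trivial_of_notMem n h
      have h2 := x.2 n
      lia
  right_inv w := by
    refine TensorIndex.ext' fun m => ?_
    simp only [Finsupp.onFinset_apply]
    have : ∀ x : TensorIndex d, x.restrict (G.F m) = (G.b m).symm (w.coord m) →
        (G.b m (x.restrict (G.F m)) : ℕ) = w.1 m := by
      intro x hx
      rw [hx, Equiv.apply_symm_apply]
      rfl
    refine this _ (funext fun n => Fin.ext ?_)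
    obtain ⟨n, hn⟩ := n
    have hg := G.g_eq m n hn
    subst hg
    exact dif_pos hn

theorem indexEquiv_coord (x : TensorIndex d) (m : ℕ) :
    (G.indexEquiv x).coord m = G.b m (x.restrict (G.F m)) := rfl

theorem restrict_indexEquiv_symm (w : TensorIndex d') (m : ℕ) :
    (G.indexEquiv.symm w).restrict (G.F m) = (G.b m).symm (w.coord m) := by
  rw [Equiv.eq_symm_apply, ← indexEquiv_coord, Equiv.apply_symm_apply]

theorem ext_coord {w z : TensorIndex d'} (h : ∀ m, w.coord m = z.coord m) : w = z :=
  TensorIndex.ext' fun m => congrArg Fin.val (h m)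

theorem coord_set (w : TensorIndex d') (m : ℕ) (j : Fin (d' m)) : (w.set m j).coord m = j :=
  Fin.ext (by simp [TensorIndex.coord, TensorIndex.set_apply])

theorem coord_set_of_ne (w : TensorIndex d') {m k : ℕ} (hk : k ≠ m) (j : Fin (d' m)) :
    (w.set m j).coord k = w.coord k :=
  Fin.ext (by simp [TensorIndex.coord, TensorIndex.set_apply, hk])

theorem notMem_of_ne {m k n : ℕ} (hk : k ≠ m) (hn : n ∈ G.F k) : n ∉ G.F m := fun h =>
  hk ((G.g_eq k n hn).symm.trans (G.g_eq m n h))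

/-- The permutation unitary given by `indexEquiv`. -/
noncomputable def unitary : TensorSpace d ≃ₗᵢ[ℂ] TensorSpace d' := lpReindex G.indexEquiv

/-- A matrix unit of a new factor is a matrix unit of the finite tensor product over its block. -/
theorem conj_symm_matrixUnit_mem (m : ℕ) (i j : Fin (d' m)) :
    G.unitary.symm.conjStarAlgEquiv (matrixUnit m i j) ∈ uhfSubalgebra d := by
  obtain ⟨E, hE, hEf⟩ := exists_mem_adjoin_eq_matrixUnit (d := d) (G.F m)
    (TensorIndex.extend G.pos (G.F m) ((G.b m).symm i))
    (TensorIndex.extend G.pos (G.F m) ((G.b m).symm j))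
  have hrestr : ∀ v : ∀ n : G.F m, Fin (d n),
      (TensorIndex.extend G.pos (G.F m) v).restrict (G.F m) = v := fun v =>
    funext fun n => Fin.ext (TensorIndex.extend_apply_mem G.pos v n.2)
  convert adjoin_le_uhfSubalgebra hE using 1
  refine ContinuousLinearMap.ext fun f => lp.ext (funext fun x => ?_)
  rw [hEf, LinearIsometryEquiv.conjStarAlgEquiv_apply_apply, LinearIsometryEquiv.symm_symm]
  change matrixUnit m i j (G.unitary f) (G.indexEquiv x) = _
  rw [matrixUnit_apply]
  have h1 : (G.indexEquiv x).1 m = i ↔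
      ∀ n ∈ G.F m, x.1 n = (TensorIndex.extend G.pos (G.F m) ((G.b m).symm i)).1 n := by
    have e1 : (G.indexEquiv x).1 m = i ↔ x.restrict (G.F m) = (G.b m).symm i := by
      rw [Equiv.eq_symm_apply, ← indexEquiv_coord, Fin.ext_iff]
      rfl
    rw [e1]
    constructor
    · intro h n hn
      rw [TensorIndex.extend_apply_mem G.pos _ hn, ← h]
      rfl
    · intro h
      funext n
      refine Fin.ext ?_
      have := h n n.2
      rw [TensorIndex.extend_apply_mem G.pos _ n.2] at this
      exact this
  have h2 : G.indexEquiv.symm ((G.indexEquiv x).set m j)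
      = (TensorIndex.extend G.pos (G.F m) ((G.b m).symm j)).piecewise (G.F m) x := by
    rw [Equiv.symm_apply_eq]
    refine ext_coord fun k => ?_
    rw [indexEquiv_coord]
    by_cases hk : k = m
    · subst hk
      rw [coord_set, ← Equiv.symm_apply_eq, ← hrestr ((G.b k).symm j)]
      funext n
      refine Fin.ext ?_
      simp only [TensorIndex.restrict, TensorIndex.coord, TensorIndex.piecewise_apply, n.2, if_true]
      rw [← hrestr ((G.b k).symm j)]
      simp [hrestr]
    · rw [coord_set_of_ne _ hk, indexEquiv_coord]
      congr 1
      funext n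
      refine Fin.ext ?_
      simp [TensorIndex.restrict, TensorIndex.coord, TensorIndex.piecewise_apply,
        G.notMem_of_ne hk n.2]
  simp only [h1]
  refine if_congr Iff.rfl ?_ rfl
  rw [← h2]
  rfl

/-- A matrix unit of an old factor is `1` if the factor lies outside the blocks, and else a sum of
matrix units of the factor that contains it. -/
theorem conj_matrixUnit_mem (n : ℕ) (i j : Fin (d n)) :
    G.unitary.conjStarAlgEquiv (matrixUnit n i j) ∈ uhfSubalgebra d' := by
  classical
  by_cases hn : n ∈ G.F (G.g n)
  swap
  · have h1 := G.trivial_of_notMem n hn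
    have : matrixUnit n i j = 1 := by
      refine ContinuousLinearMap.ext fun f => lp.ext (funext fun x => ?_)
      rw [matrixUnit_apply, if_pos (by have := x.2 n; lia)]
      have : x.set n j = x := TensorIndex.ext' fun k => by
        rw [TensorIndex.set_apply]
        split_ifs with h
        · subst h; have := x.2 k; lia
        · rfl
      rw [this]
      rfl
    rw [this, map_one]
    exact one_mem _
  obtain ⟨m, hm⟩ : ∃ m, G.g n = m := ⟨_, rfl⟩
  rw [hm] at hn
  -- `up a` is the block index `a` with its coordinate at `n` replaced by `j`.
  let up : Fin (d' m) → Fin (d' m) := fun a => G.b m (Function.update ((G.b m).symm a) ⟨n, hn⟩ j)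
  have hsum : G.unitary.conjStarAlgEquiv (matrixUnit n i j)
      = ∑ a : Fin (d' m), if (G.b m).symm a ⟨n, hn⟩ = i then matrixUnit m a (up a) else 0 := by
    refine ContinuousLinearMap.ext fun f => lp.ext (funext fun w => ?_)
    have hR : ∀ a : Fin (d' m), coeff w ((if (G.b m).symm a ⟨n, hn⟩ = i
        then matrixUnit m a (up a) else 0) f)
          = if a = w.coord m then
              if (G.b m).symm a ⟨n, hn⟩ = i then f (w.set m (up a)) else 0 else 0 := by
      intro a
      have ha : w.1 m = a ↔ a = w.coord m := by
        rw [Fin.ext_iff]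
        exact eq_comm
      by_cases h : (G.b m).symm a ⟨n, hn⟩ = i
      · simp only [h, if_true, coeff_apply, matrixUnit_apply, ha]
      · simp [h]
    have hsumR : coeff w ((∑ a : Fin (d' m),
        if (G.b m).symm a ⟨n, hn⟩ = i then matrixUnit m a (up a) else 0) f)
          = if (G.b m).symm (w.coord m) ⟨n, hn⟩ = i then f (w.set m (up (w.coord m))) else 0 := by
      rw [sum_apply, map_sum]
      simp only [hR, Finset.sum_ite_eq', Finset.mem_univ, if_true]
    refine Eq.trans ?_ hsumR.symm
    change matrixUnit n i j (G.unitary.symm f) (G.indexEquiv.symm w) = _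
    rw [matrixUnit_apply, ← restrict_indexEquiv_symm]
    have h1 : (G.indexEquiv.symm w).1 n = i ↔
        (G.indexEquiv.symm w).restrict (G.F m) ⟨n, hn⟩ = i := by
      rw [Fin.ext_iff]; rfl
    have h2 : G.indexEquiv ((G.indexEquiv.symm w).set n j) = w.set m (up (w.coord m)) := by
      refine ext_coord fun k => ?_
      rw [indexEquiv_coord]
      by_cases hk : k = m
      · subst hk
        rw [coord_set]
        simp only [up]
        congr 1
        funext l
        refine Fin.ext ?_
        rw [← restrict_indexEquiv_symm]
        by_cases hl : l = ⟨n, hn⟩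
        · subst hl
          simp [TensorIndex.restrict, TensorIndex.coord, TensorIndex.set_apply]
        · have hl' : (l : ℕ) ≠ n := fun h => hl (Subtype.ext h)
          simp [TensorIndex.restrict, TensorIndex.coord, TensorIndex.set_apply, hl, hl']
      · rw [coord_set_of_ne _ hk, ← Equiv.eq_symm_apply, ← restrict_indexEquiv_symm]
        funext l
        have hl' : (l : ℕ) ≠ n := fun h => G.notMem_of_ne hk l.2 (h ▸ hn)
        exact Fin.ext (by
          simp [TensorIndex.restrict, TensorIndex.coord, TensorIndex.set_apply, hl'])
    simp only [h1]
    refine if_congr Iff.rfl ?_ rfl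
    rw [← h2]
    rfl
  rw [hsum]
  refine sum_mem fun a _ => ?_
  split_ifs
  · exact adjoin_le_uhfSubalgebra (matrixUnit_mem_adjoin _ _ _)
  · exact zero_mem _

end Grouping

theorem exists_equiv_map_eq {α β : Type*} [DecidableEq β] (e : α ≃ β) (a : α) (b : β) :
    ∃ e' : α ≃ β, e' a = b :=
  ⟨e.trans (Equiv.swap (e a) b), by simp⟩

/-- Tensor factors can be grouped into blocks and reordered, and trivial factors can be dropped. -/
theorem nonempty_uhf_equiv_of_blocks (hd : ∀ n, 0 < d n) (F : ℕ → Finset ℕ)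
    (hF : Pairwise fun k m => Disjoint (F k) (F m)) (hcov : ∀ n, d n ≠ 1 → ∃ m, n ∈ F m)
    (hprod : ∀ m, ∏ n ∈ F m, d n = d' m) : Nonempty (UHF d ≃⋆ₐ[ℂ] UHF d') := by
  classical
  have hd' : ∀ m, 0 < d' m := fun m => hprod m ▸ Finset.prod_pos fun n _ => hd n
  have hb : ∀ m, ∃ b : (∀ n : F m, Fin (d n)) ≃ Fin (d' m),
      b (fun n => ⟨0, hd n⟩) = ⟨0, hd' m⟩ := fun m =>
    exists_equiv_map_eq (Fintype.equivFinOfCardEq (by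
      rw [Fintype.card_pi]
      simp only [Fintype.card_fin]
      exact (Finset.prod_coe_sort (F m) d).trans (hprod m))) _ _
  choose b hb using hb
  let g : ℕ → ℕ := fun n => if h : ∃ m, n ∈ F m then h.choose else 0
  have hg : ∀ m, ∀ n ∈ F m, g n = m := fun m n hn => by
    have h : ∃ m, n ∈ F m := ⟨m, hn⟩
    simp only [g, h, dif_pos]
    by_contra hne
    exact Finset.disjoint_left.1 (hF hne) h.choose_spec hn
  let G : Grouping d d' :=
    { pos := hd
      pos' := hd'
      F := F
      g := g
      g_eq := hg
      trivial_of_notMem := fun n hn => by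
        by_contra h1
        obtain ⟨m, hm⟩ := hcov n h1
        exact hn (by rwa [hg m n hm])
      b := b
      b_zero := hb }
  exact nonempty_uhf_equiv_of_unitary G.unitary G.conj_matrixUnit_mem G.conj_symm_matrixUnit_mem

end Grouping

end RandomUHF

/-! ### Perturbation of projections -/

namespace RandomUHF

section Projections

variable {A : Type*} [CStarAlgebra A]

/-- A self-adjoint element of a closed *-subalgebra that is close to a projection is close to a
projection of the subalgebra, namely to its image under a continuous function that rounds the
spectrum to `{0, 1}`. -/
theorem exists_isStarProjection_mem (S : StarSubalgebra ℂ A) (hS : IsClosed (S : Set A)) {p a : A}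
    (hp : IsStarProjection p) (ha : IsSelfAdjoint a) (haS : a ∈ S) (hap : ‖a - p‖ < 1 / 32) :
    ∃ e ∈ S, IsStarProjection e ∧ ‖e - p‖ < 1 / 2 := by
  have hp1 : ‖p‖ ≤ 1 := hp.norm_le
  have ha1 : ‖a‖ ≤ 2 := by
    have := norm_add_le (a - p) p
    rw [sub_add_cancel] at this
    linarith
  have hquad : ‖a * a - a‖ < 3 / 16 := by
    have h1 : a * a - a = (a - p) * a + p * (a - p) - (a - p) := by
      rw [sub_mul, mul_sub, hp.isIdempotentElem.eq]; abel
    have h2 := norm_sub_le ((a - p) * a + p * (a - p)) (a - p)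
    have h3 := norm_add_le ((a - p) * a) (p * (a - p))
    have h4 := norm_mul_le (a - p) a
    have h5 := norm_mul_le p (a - p)
    rw [h1]
    have h6 : ‖a - p‖ * ‖a‖ ≤ ‖a - p‖ * 2 := mul_le_mul_of_nonneg_left ha1 (norm_nonneg _)
    have h7 : ‖p‖ * ‖a - p‖ ≤ 1 * ‖a - p‖ := mul_le_mul_of_nonneg_right hp1 (norm_nonneg _)
    linarith
  have hspec : ∀ x ∈ spectrum ℝ a, |x * x - x| < 3 / 16 := by
    intro x hx
    have h1 := norm_apply_le_norm_cfc (fun x : ℝ => x * x - x) a hx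
    rw [cfc_sub (fun x : ℝ => x * x) (fun x => x) a, cfc_mul (fun x : ℝ => x) (fun x => x) a,
      cfc_id' ℝ a] at h1
    exact h1.trans_lt hquad
  let f : ℝ → ℝ := fun x => max 0 (min 1 (2 * x - 1 / 2))
  have hf : Continuous f := by fun_prop
  have hround : ∀ x ∈ spectrum ℝ a, (x < 1 / 4 ∧ -1 / 4 < x ∧ f x = 0) ∨
      (3 / 4 < x ∧ x < 5 / 4 ∧ f x = 1) := by
    intro x hx
    have h1 := abs_lt.1 (hspec x hx)
    rcases lt_or_ge x (1 / 4) with h2 | h2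
    · refine Or.inl ⟨h2, by nlinarith, ?_⟩
      exact max_eq_left ((min_le_right _ _).trans (by linarith))
    · have h3 : 3 / 4 < x := by
        by_contra! h3
        nlinarith
      refine Or.inr ⟨h3, by nlinarith, ?_⟩
      simp only [f]
      rw [min_eq_left (by linarith), max_eq_right (by norm_num)]
  have : IsClosed (S : Set A) := hS
  refine ⟨cfc f a, cfc_mem f haS, ⟨?_, IsSelfAdjoint.cfc⟩, ?_⟩
  · change cfc f a * cfc f a = cfc f a
    rw [← cfc_mul f f a hf.continuousOn hf.continuousOn]
    refine cfc_congr fun x hx => ?_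
    rcases hround x hx with ⟨-, -, h⟩ | ⟨-, -, h⟩ <;> simp [h]
  · have hfa : ‖cfc f a - a‖ ≤ 1 / 4 := by
      have h1 : cfc f a - a = cfc (fun x => f x - x) a := by
        rw [cfc_sub f (fun x => x) a hf.continuousOn continuousOn_id, cfc_id' ℝ a]
      rw [h1]
      refine norm_cfc_le (by norm_num) fun x hx => ?_
      rw [Real.norm_eq_abs, abs_le]
      rcases hround x hx with ⟨h1, h2, h⟩ | ⟨h1, h2, h⟩ <;> rw [h] <;> constructor <;> linarith
    have h2 := norm_add_le (cfc f a - a) (a - p)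
    rw [sub_add_sub_cancel] at h2
    linarith

/-- Two close projections in a closed *-subalgebra are similar in it, hence they are of the form
`x * y` and `y * x`. -/
theorem exists_eq_mul_of_norm_sub_lt (S : StarSubalgebra ℂ A) (hS : IsClosed (S : Set A)) {p e : A}
    (hp : IsStarProjection p) (he : IsStarProjection e) (hpS : p ∈ S) (heS : e ∈ S)
    (h : ‖e - p‖ < 1 / 2) : ∃ x ∈ S, ∃ y ∈ S, p = x * y ∧ e = y * x := by
  have hpp := hp.isIdempotentElem.eq
  have hee := he.isIdempotentElem.eq
  set z := e * p + (1 - e) * (1 - p) with hz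
  have hzS : z ∈ S := add_mem (mul_mem heS hpS)
    (mul_mem (sub_mem (one_mem S) heS) (sub_mem (one_mem S) hpS))
  have hez : e * z = z * p := by
    have h1 : e * z = e * p := by
      simp only [hz, mul_add, mul_sub, sub_mul, one_mul, mul_one, ← mul_assoc, hee]; abel
    have h2 : z * p = e * p := by
      simp only [hz, add_mul, mul_sub, sub_mul, one_mul, mul_one, mul_assoc, hpp]; abel
    rw [h1, h2]
  have hnorm : ‖1 - z‖ < 1 := by
    have h1 : 1 - z = e * (e - p) - (e - p) * p := by
      simp only [hz, mul_sub, sub_mul, one_mul, mul_one, hee, hpp]; abel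
    rw [h1]
    have h2 := norm_sub_le (e * (e - p)) ((e - p) * p)
    have h3 := norm_mul_le e (e - p)
    have h4 := norm_mul_le (e - p) p
    have h5 : ‖e‖ * ‖e - p‖ ≤ 1 * ‖e - p‖ := mul_le_mul_of_nonneg_right he.norm_le (norm_nonneg _)
    have h6 : ‖e - p‖ * ‖p‖ ≤ ‖e - p‖ * 1 := mul_le_mul_of_nonneg_left hp.norm_le (norm_nonneg _)
    linarith
  have hunit : IsUnit z := by
    have := isUnit_one_sub_of_norm_lt_one hnorm
    rwa [sub_sub_cancel] at this
  have : IsClosed (S : Set A) := hS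
  obtain ⟨u, hu⟩ := (S.coe_isUnit (a := ⟨z, hzS⟩)).1 hunit
  have h1 : ((u⁻¹ : Sˣ) : S).1 * z = 1 := by
    have := congrArg Subtype.val u.inv_mul
    rwa [hu] at this
  have h2 : z * ((u⁻¹ : Sˣ) : S).1 = 1 := by
    have := congrArg Subtype.val u.mul_inv
    rwa [hu] at this
  refine ⟨((u⁻¹ : Sˣ) : S).1, ((u⁻¹ : Sˣ) : S).2, e * z, mul_mem heS hzS, ?_, ?_⟩
  · rw [hez, ← mul_assoc, h1, one_mul]
  · rw [mul_assoc, h2, mul_one]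

end Projections

theorem exists_natCast_eq_trace {ι : Type*} [Fintype ι] [DecidableEq ι] {e : Matrix ι ι ℂ}
    (he : IsIdempotentElem e) : ∃ m : ℕ, e.trace = m := by
  have h : IsIdempotentElem (Matrix.toLin' e) := by
    change Matrix.toLin' e * Matrix.toLin' e = Matrix.toLin' e
    rw [Module.End.mul_eq_comp, ← Matrix.toLin'_mul, he.eq]
  refine ⟨Module.finrank ℂ (LinearMap.range (Matrix.toLin' e)), ?_⟩
  rw [← Matrix.trace_toLin'_eq]
  exact (LinearMap.IsIdempotentElem.isProj_range _ h).trace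

end RandomUHF

/-! ### Approximate traces and the supernatural number -/

namespace RandomUHF

open Filter Topology

section LocalAlgebra

variable {d : ℕ → ℕ}

theorem TensorIndex.set_set (x : TensorIndex d) (n : ℕ) (i j : Fin (d n)) :
    (x.set n i).set n j = x.set n j := TensorIndex.ext' fun k => by
  simp only [TensorIndex.set_apply]; split_ifs <;> rfl

theorem TensorIndex.set_eq_self {x : TensorIndex d} {n : ℕ} {j : Fin (d n)} (h : x.1 n = j) :
    x.set n j = x := TensorIndex.ext' fun k => by
  rw [TensorIndex.set_apply]; split_ifs with hk
  · rw [hk, h]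
  · rfl

theorem TensorIndex.set_comm (x : TensorIndex d) {n m : ℕ} (h : n ≠ m) (i : Fin (d n))
    (j : Fin (d m)) : (x.set n i).set m j = (x.set m j).set n i := TensorIndex.ext' fun k => by
  simp only [TensorIndex.set_apply]; split_ifs <;> lia

theorem TensorIndex.set_apply_self (x : TensorIndex d) (n : ℕ) (j : Fin (d n)) :
    (x.set n j).1 n = j := by simp [TensorIndex.set_apply]

theorem TensorIndex.set_apply_of_ne (x : TensorIndex d) {n k : ℕ} (h : k ≠ n) (j : Fin (d n)) :
    (x.set n j).1 k = x.1 k := by simp [TensorIndex.set_apply, h]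

theorem star_matrixUnit (n : ℕ) (i j : Fin (d n)) :
    star (matrixUnit n i j) = matrixUnit n j i := by
  symm
  rw [ContinuousLinearMap.star_eq_adjoint, ContinuousLinearMap.eq_adjoint_iff]
  intro f g
  rw [lp.inner_eq_tsum, lp.inner_eq_tsum]
  refine tsum_eq_tsum_of_ne_zero_bij (fun x => x.1.set n j) ?_ ?_ ?_
  · intro x y hxy
    have hmem : ∀ z : Function.support fun z => inner ℂ (f z) (matrixUnit n i j g z),
        z.1.1 n = i := fun z => by
      by_contra h
      refine z.2 ?_
      simp only [matrixUnit_apply, h, if_false, inner_zero_right]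
    exact Subtype.ext (TensorIndex.set_injOn n i j (hmem x) (hmem y) hxy)
  · intro y hy
    have hyj : y.1 n = j := by
      by_contra h
      refine hy ?_
      simp only [matrixUnit_apply, h, if_false, inner_zero_left]
    refine ⟨⟨y.set n i, ?_⟩, ?_⟩
    · rw [Function.mem_support] at hy ⊢
      simp only [matrixUnit_apply, hyj, if_true] at hy
      simp only [matrixUnit_apply, TensorIndex.set_apply_self, if_true, TensorIndex.set_set,
        TensorIndex.set_eq_self hyj]
      exact hy
    · simp only [TensorIndex.set_set, TensorIndex.set_eq_self hyj]
  · intro x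
    have hxi : x.1.1 n = i := by
      by_contra h
      refine x.2 ?_
      simp only [matrixUnit_apply, h, if_false, inner_zero_right]
    simp only [matrixUnit_apply, TensorIndex.set_apply_self, if_true, TensorIndex.set_set,
      TensorIndex.set_eq_self hxi, hxi]

theorem matrixUnit_comm {n m : ℕ} (h : n ≠ m) (i j : Fin (d n)) (k l : Fin (d m)) :
    matrixUnit n i j * matrixUnit m k l = matrixUnit m k l * matrixUnit n i j := by
  refine ContinuousLinearMap.ext fun f => lp.ext (funext fun x => ?_)
  simp only [mul_apply_eq_comp, matrixUnit_apply, TensorIndex.set_apply_of_ne _ h,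
    TensorIndex.set_apply_of_ne _ h.symm, TensorIndex.set_comm x h]
  split_ifs <;> rfl

theorem matrixUnit_basisVec {n : ℕ} (i j : Fin (d n)) {x : TensorIndex d} (hx : x.1 n = j) :
    matrixUnit n i j (basisVec x) = basisVec (x.set n i) := by
  refine lp.ext (funext fun z => ?_)
  rw [matrixUnit_apply, basisVec_apply, basisVec_apply, ← ite_and]
  refine if_congr ⟨?_, ?_⟩ rfl rfl
  · rintro ⟨h, rfl⟩
    rw [TensorIndex.set_set, TensorIndex.set_eq_self h]
  · rintro rfl
    exact ⟨TensorIndex.set_apply_self _ _ _, by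
      rw [TensorIndex.set_set, TensorIndex.set_eq_self hx]⟩

/-- The operators on the first `M` tensor factors, described as the commutant of all the other
tensor factors. -/
noncomputable def localAlgebra (d : ℕ → ℕ) (M : ℕ) :
    StarSubalgebra ℂ (TensorSpace d →L[ℂ] TensorSpace d) :=
  StarSubalgebra.centralizer ℂ {T | ∃ (n : ℕ) (_ : M ≤ n) (i j : Fin (d n)), T = matrixUnit n i j}

theorem mem_localAlgebra {M : ℕ} {T : TensorSpace d →L[ℂ] TensorSpace d} :
    T ∈ localAlgebra d M ↔
      ∀ n, M ≤ n → ∀ i j : Fin (d n), matrixUnit n i j * T = T * matrixUnit n i j := by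
  rw [localAlgebra, StarSubalgebra.mem_centralizer_iff]
  constructor
  · intro h n hn i j
    exact (h _ ⟨n, hn, i, j, rfl⟩).1
  · rintro h _ ⟨n, hn, i, j, rfl⟩
    rw [star_matrixUnit]
    exact ⟨h n hn i j, h n hn j i⟩

theorem localAlgebra_mono {M N : ℕ} (h : M ≤ N) : localAlgebra d M ≤ localAlgebra d N :=
  fun _ hT => mem_localAlgebra.2 fun n hn => mem_localAlgebra.1 hT n (h.trans hn)

theorem isClosed_localAlgebra (M : ℕ) :
    IsClosed (localAlgebra d M : Set (TensorSpace d →L[ℂ] TensorSpace d)) := by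
  rw [localAlgebra, StarSubalgebra.coe_centralizer]
  exact Set.isClosed_centralizer _

theorem exists_mem_localAlgebra {T : TensorSpace d →L[ℂ] TensorSpace d}
    (hT : T ∈ StarAlgebra.adjoin ℂ (matrixUnits d)) : ∃ M, T ∈ localAlgebra d M := by
  induction hT using StarAlgebra.adjoin_induction with
  | mem T hT =>
    obtain ⟨n, i, j, rfl⟩ := hT
    exact ⟨n + 1, mem_localAlgebra.2 fun m hm k l => matrixUnit_comm (by lia) k l i j⟩
  | algebraMap r => exact ⟨0, algebraMap_mem _ r⟩
  | add S T _ _ hS hT =>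
    obtain ⟨M, hM⟩ := hS
    obtain ⟨N, hN⟩ := hT
    exact ⟨max M N, add_mem (localAlgebra_mono (le_max_left M N) hM)
      (localAlgebra_mono (le_max_right M N) hN)⟩
  | mul S T _ _ hS hT =>
    obtain ⟨M, hM⟩ := hS
    obtain ⟨N, hN⟩ := hT
    exact ⟨max M N, mul_mem (localAlgebra_mono (le_max_left M N) hM)
      (localAlgebra_mono (le_max_right M N) hN)⟩
  | star T _ hT =>
    obtain ⟨M, hM⟩ := hT
    exact ⟨M, star_mem hM⟩

end LocalAlgebra

section Trace

variable {d : ℕ → ℕ} (hd : ∀ n, 0 < d n)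

/-- The index that starts with `v` and continues with zeros. -/
noncomputable def initIndex {M : ℕ} (v : ∀ n : Fin M, Fin (d n)) : TensorIndex d :=
  TensorIndex.extend hd (Finset.range M) fun n => v ⟨n, Finset.mem_range.1 n.2⟩

theorem initIndex_apply_of_lt {M : ℕ} (v : ∀ n : Fin M, Fin (d n)) (n : Fin M) :
    (initIndex hd v).1 n = v n :=
  TensorIndex.extend_apply_mem hd _ (Finset.mem_range.2 n.2)

theorem initIndex_apply_of_le {M : ℕ} (v : ∀ n : Fin M, Fin (d n)) {n : ℕ} (h : M ≤ n) :
    (initIndex hd v).1 n = 0 :=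
  TensorIndex.extend_apply_notMem hd _ (by simpa using h)

theorem initIndex_injective (M : ℕ) :
    Function.Injective (initIndex hd : (∀ n : Fin M, Fin (d n)) → TensorIndex d) := by
  intro v w h
  funext n
  refine Fin.ext ?_
  rw [← initIndex_apply_of_lt hd v, ← initIndex_apply_of_lt hd w, h]

theorem exists_initIndex_eq {M : ℕ} {x : TensorIndex d} (h : ∀ n, M ≤ n → x.1 n = 0) :
    ∃ v : ∀ n : Fin M, Fin (d n), initIndex hd v = x := by
  refine ⟨fun n => x.coord n, TensorIndex.ext' fun n => ?_⟩
  by_cases hn : n < M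
  · exact initIndex_apply_of_lt hd _ ⟨n, hn⟩
  · rw [initIndex_apply_of_le hd _ (not_lt.1 hn), h n (not_lt.1 hn)]

/-- The compression of an operator to the first `M` tensor factors, as a matrix. -/
noncomputable def compression (M : ℕ) (T : TensorSpace d →L[ℂ] TensorSpace d) :
    Matrix (∀ n : Fin M, Fin (d n)) (∀ n : Fin M, Fin (d n)) ℂ :=
  Matrix.of fun u v => coeff (initIndex hd u) (T (basisVec (initIndex hd v)))

/-- Operators on the first `M` factors map the basis vectors of these factors to linear
combinations of such basis vectors. -/
theorem apply_basisVec_of_mem_localAlgebra {M : ℕ} {T : TensorSpace d →L[ℂ] TensorSpace d}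
    (hT : T ∈ localAlgebra d M) (v : ∀ n : Fin M, Fin (d n)) :
    T (basisVec (initIndex hd v))
      = ∑ u, compression hd M T u v • basisVec (initIndex hd u) := by
  refine lp.ext (funext fun y => ?_)
  change coeff y _ = coeff y _
  simp only [map_sum, map_smul, smul_eq_mul, coeff_apply y (basisVec _), basisVec_apply]
  by_cases hy : ∀ n, M ≤ n → y.1 n = 0
  · obtain ⟨u, rfl⟩ := exists_initIndex_eq hd hy
    simp only [(initIndex_injective hd M).eq_iff, mul_ite, mul_one, mul_zero, Finset.sum_ite_eq,
      Finset.mem_univ, if_true]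
    rfl
  · push Not at hy
    obtain ⟨n, hn, hyn⟩ := hy
    have h1 : T (basisVec (initIndex hd v))
        = matrixUnit n ⟨0, hd n⟩ ⟨0, hd n⟩ (T (basisVec (initIndex hd v))) := by
      have h2 := congrArg (fun S => S (basisVec (initIndex hd v)))
        (mem_localAlgebra.1 hT n hn ⟨0, hd n⟩ ⟨0, hd n⟩)
      have h0 : (initIndex hd v).1 n = ((⟨0, hd n⟩ : Fin (d n)) : ℕ) :=
        initIndex_apply_of_le hd v hn
      simp only [mul_apply_eq_comp, matrixUnit_basisVec _ _ h0, TensorIndex.set_eq_self h0] at h2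
      exact h2.symm
    rw [h1, coeff_apply, matrixUnit_apply, if_neg hyn, Finset.sum_eq_zero]
    intro u _
    rw [if_neg, mul_zero]
    rintro rfl
    exact hyn (initIndex_apply_of_le hd u hn)

theorem compression_mul {M : ℕ} (S : TensorSpace d →L[ℂ] TensorSpace d)
    {T : TensorSpace d →L[ℂ] TensorSpace d} (hT : T ∈ localAlgebra d M) :
    compression hd M (S * T) = compression hd M S * compression hd M T := by
  ext u v
  rw [Matrix.mul_apply]
  change coeff _ ((S * T) _) = _
  rw [mul_apply_eq_comp, apply_basisVec_of_mem_localAlgebra hd hT, map_sum, map_sum]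
  refine Finset.sum_congr rfl fun w _ => ?_
  rw [map_smul, map_smul, smul_eq_mul, mul_comm]
  rfl

/-- The normalized trace of the compression to the first `M` factors. -/
noncomputable def approxTrace (M : ℕ) : (TensorSpace d →L[ℂ] TensorSpace d) →ₗ[ℂ] ℂ where
  toFun T := (compression hd M T).trace / (∏ n ∈ Finset.range M, d n : ℕ)
  map_add' S T := by
    rw [← add_div, ← Matrix.trace_add]
    rfl
  map_smul' c T := by
    rw [RingHom.id_apply, smul_eq_mul, ← mul_div_assoc, ← smul_eq_mul, ← Matrix.trace_smul]
    rfl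

theorem approxTrace_apply (M : ℕ) (T : TensorSpace d →L[ℂ] TensorSpace d) :
    approxTrace hd M T = (compression hd M T).trace / (∏ n ∈ Finset.range M, d n : ℕ) := rfl

theorem card_init (M : ℕ) :
    Fintype.card (∀ n : Fin M, Fin (d n)) = ∏ n ∈ Finset.range M, d n := by
  rw [Fintype.card_pi]
  simp only [Fintype.card_fin]
  exact Fin.prod_univ_eq_prod_range d M

theorem prod_range_ne_zero (hd : ∀ n, 0 < d n) (M : ℕ) :
    ((∏ n ∈ Finset.range M, d n : ℕ) : ℂ) ≠ 0 :=
  Nat.cast_ne_zero.2 (Finset.prod_pos fun n _ => hd n).ne'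

theorem norm_basisVec (x : TensorIndex d) : ‖basisVec x‖ = 1 := by
  rw [basisVec, lp.norm_single (by simp)]
  simp

theorem norm_approxTrace_le (M : ℕ) (T : TensorSpace d →L[ℂ] TensorSpace d) :
    ‖approxTrace hd M T‖ ≤ ‖T‖ := by
  have hpos : (0 : ℝ) < (∏ n ∈ Finset.range M, d n : ℕ) :=
    Nat.cast_pos.2 (Finset.prod_pos fun n _ => hd n)
  rw [approxTrace_apply, norm_div, Complex.norm_natCast, div_le_iff₀ hpos, Matrix.trace]
  refine (norm_sum_le_of_le (n := fun _ => ‖T‖) _ fun v _ => ?_).trans ?_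
  · refine (lp.norm_apply_le_norm (by simp) (T (basisVec (initIndex hd v))) _).trans ?_
    refine (T.le_opNorm _).trans ?_
    rw [norm_basisVec, mul_one]
  · rw [Finset.sum_const, Finset.card_univ, card_init, nsmul_eq_mul, mul_comm]

theorem approxTrace_one (M : ℕ) : approxTrace hd M 1 = 1 := by
  have h : compression hd M (1 : TensorSpace d →L[ℂ] TensorSpace d) = 1 := by
    ext u v
    change basisVec (initIndex hd v) (initIndex hd u) = _
    rw [basisVec_apply, Matrix.one_apply]
    simp only [(initIndex_injective hd M).eq_iff]
  rw [approxTrace_apply, h, Matrix.trace_one, card_init, div_self (prod_range_ne_zero hd M)]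

theorem approxTrace_mul_comm {M N : ℕ} (hMN : M ≤ N) {S T : TensorSpace d →L[ℂ] TensorSpace d}
    (hS : S ∈ localAlgebra d M) (hT : T ∈ localAlgebra d M) :
    approxTrace hd N (S * T - T * S) = 0 := by
  rw [map_sub, approxTrace_apply, approxTrace_apply,
    compression_mul hd S (localAlgebra_mono hMN hT), compression_mul hd T (localAlgebra_mono hMN hS), Matrix.trace_mul_comm, sub_self]

/-- On operators on the first `M` factors, the normalized traces on more factors agree. -/
theorem approxTrace_succ {M : ℕ} {T : TensorSpace d →L[ℂ] TensorSpace d}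
    (hT : T ∈ localAlgebra d M) : approxTrace hd (M + 1) T = approxTrace hd M T := by
  have hsnoc : ∀ (j : Fin (d M)) (v : ∀ n : Fin M, Fin (d n)),
      initIndex hd (M := M + 1) (Fin.snoc (α := fun n : Fin (M + 1) => Fin (d n)) v j)
        = (initIndex hd v).set M j := by
    intro j v
    refine TensorIndex.ext' fun n => ?_
    rcases lt_trichotomy n M with hn | rfl | hn
    · rw [TensorIndex.set_apply_of_ne _ hn.ne, initIndex_apply_of_lt hd v ⟨n, hn⟩,
        initIndex_apply_of_lt hd _ ⟨n, hn.trans M.lt_succ_self⟩]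
      exact congrArg Fin.val (Fin.snoc_castSucc (α := fun n : Fin (M + 1) => Fin (d n)) j v ⟨n, hn⟩)
    · rw [TensorIndex.set_apply_self, initIndex_apply_of_lt hd _ ⟨n, n.lt_succ_self⟩]
      exact congrArg Fin.val (Fin.snoc_last (α := fun k : Fin (n + 1) => Fin (d k)) j v)
    · rw [TensorIndex.set_apply_of_ne _ hn.ne', initIndex_apply_of_le hd _ hn,
        initIndex_apply_of_le hd v hn.le]
  have hdiag : ∀ (j : Fin (d M)) (v : ∀ n : Fin M, Fin (d n)),
      coeff ((initIndex hd v).set M j) (T (basisVec ((initIndex hd v).set M j)))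
        = compression hd M T v v := by
    intro j v
    have h0 : (initIndex hd v).1 M = ((⟨0, hd M⟩ : Fin (d M)) : ℕ) :=
      initIndex_apply_of_le hd v le_rfl
    have h2 := congrArg (fun S => S (basisVec (initIndex hd v)))
      (mem_localAlgebra.1 hT M le_rfl j ⟨0, hd M⟩)
    simp only [mul_apply_eq_comp, matrixUnit_basisVec _ _ h0] at h2
    rw [← h2, coeff_apply, matrixUnit_apply, if_pos (TensorIndex.set_apply_self _ _ _),
      TensorIndex.set_set, TensorIndex.set_eq_self h0]
    rfl
  have htrace : (compression hd (M + 1) T).trace = d M * (compression hd M T).trace := by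
    rw [Matrix.trace, ← (Fin.snocEquiv fun n : Fin (M + 1) => Fin (d n)).sum_comp,
      Fintype.sum_prod_type]
    have : ∀ (j : Fin (d M)) (v : ∀ n : Fin M, Fin (d n)),
        (compression hd (M + 1) T).diag
          (Fin.snocEquiv (fun n : Fin (M + 1) => Fin (d n)) (j, v)) = compression hd M T v v := by
      intro j v
      rw [← hdiag j v, ← hsnoc j v]
      rfl
    refine (Finset.sum_congr rfl fun j _ => Finset.sum_congr rfl fun v _ => this j v).trans ?_
    rw [Finset.sum_const, Finset.card_univ, nsmul_eq_mul]
    congr 2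
    exact Fintype.card_fin (d M)
  have h3 : (d M : ℂ) ≠ 0 := Nat.cast_ne_zero.2 (hd M).ne'
  rw [approxTrace_apply, approxTrace_apply, htrace, Finset.prod_range_succ, Nat.cast_mul,
    mul_comm ((∏ n ∈ Finset.range M, d n : ℕ) : ℂ), mul_div_mul_left _ _ h3]

theorem approxTrace_of_le {M N : ℕ} (hMN : M ≤ N) {T : TensorSpace d →L[ℂ] TensorSpace d}
    (hT : T ∈ localAlgebra d M) : approxTrace hd N T = approxTrace hd M T := by
  induction hMN with
  | refl => rfl
  | step h ih => rw [approxTrace_succ hd (localAlgebra_mono h hT), ih]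

/-- Uniformly bounded linear functionals that tend to zero on a set tend to zero on its closure. -/
theorem tendsto_zero_of_mem_closure {E : Type*} [SeminormedAddCommGroup E] [Module ℂ E]
    {F : ℕ → E →ₗ[ℂ] ℂ} {C : ℝ} (hC : ∀ N x, ‖F N x‖ ≤ C * ‖x‖) {s : Set E}
    (hs : ∀ x ∈ s, Tendsto (fun N => F N x) atTop (𝓝 0)) {x : E} (hx : x ∈ closure s) :
    Tendsto (fun N => F N x) atTop (𝓝 0) := by
  rw [Metric.tendsto_atTop]
  intro ε hε
  have hC' : 0 < |C| + 1 := by positivity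
  obtain ⟨y, hy, hxy⟩ := Metric.mem_closure_iff.1 hx (ε / 2 / (|C| + 1)) (by positivity)
  obtain ⟨N, hN⟩ := Metric.tendsto_atTop.1 (hs y hy) (ε / 2) (by positivity)
  refine ⟨N, fun n hn => ?_⟩
  have h1 := hN n hn
  rw [dist_zero_right] at h1 ⊢
  rw [dist_eq_norm, lt_div_iff₀ hC'] at hxy
  have h2 : F n x = F n (x - y) + F n y := by rw [map_sub, sub_add_cancel]
  have h3 := norm_add_le (F n (x - y)) (F n y)
  have h4 := hC n (x - y)
  have h5 : C * ‖x - y‖ ≤ ‖x - y‖ * (|C| + 1) := by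
    rw [mul_comm]
    exact mul_le_mul_of_nonneg_left ((le_abs_self C).trans (by linarith)) (norm_nonneg _)
  rw [h2]
  linarith

/-- The normalized traces on the first factors are asymptotically tracial on the whole infinite
tensor product. -/
theorem tendsto_approxTrace_commutator {S T : TensorSpace d →L[ℂ] TensorSpace d}
    (hS : S ∈ uhfSubalgebra d) (hT : T ∈ uhfSubalgebra d) :
    Tendsto (fun N => approxTrace hd N (S * T - T * S)) atTop (𝓝 0) := by
  have hbound : ∀ N (S T : TensorSpace d →L[ℂ] TensorSpace d),
      ‖approxTrace hd N (S * T - T * S)‖ ≤ 2 * ‖T‖ * ‖S‖ := by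
    intro N S T
    refine (norm_approxTrace_le hd N _).trans ?_
    have h1 := norm_sub_le (S * T) (T * S)
    have h2 := norm_mul_le S T
    have h3 := norm_mul_le T S
    linarith
  have hadj : ∀ S ∈ StarAlgebra.adjoin ℂ (matrixUnits d),
      ∀ T ∈ StarAlgebra.adjoin ℂ (matrixUnits d),
      Tendsto (fun N => approxTrace hd N (S * T - T * S)) atTop (𝓝 0) := by
    intro S hS T hT
    obtain ⟨K, hK⟩ := exists_mem_localAlgebra hS
    obtain ⟨L, hL⟩ := exists_mem_localAlgebra hT
    refine tendsto_const_nhds.congr' ?_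
    filter_upwards [eventually_ge_atTop (max K L)] with N hN
    exact (approxTrace_mul_comm hd hN (localAlgebra_mono (le_max_left K L) hK)
      (localAlgebra_mono (le_max_right K L) hL)).symm
  have hleft : ∀ T ∈ StarAlgebra.adjoin ℂ (matrixUnits d),
      Tendsto (fun N => approxTrace hd N (S * T - T * S)) atTop (𝓝 0) := fun T hT =>
    tendsto_zero_of_mem_closure
      (F := fun N => (approxTrace hd N).comp (LinearMap.mulRight ℂ T - LinearMap.mulLeft ℂ T))
      (fun N S => hbound N S T) (fun S hS => hadj S hS T hT) hS
  refine tendsto_zero_of_mem_closure (C := 2 * ‖S‖)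
      (F := fun N => (approxTrace hd N).comp (LinearMap.mulLeft ℂ S - LinearMap.mulRight ℂ S))
      (fun N T => (hbound N S T).trans_eq (by ring)) hleft hT

/-- If the matrix algebra `M_R` embeds unitally in the infinite tensor product, then `R` divides
the size of a finite tensor product: a minimal projection of `M_R` has asymptotic trace `1 / R`,
and it is similar to a projection on finitely many factors, whose trace is a fraction with
denominator the size of this finite tensor product. -/
theorem exists_dvd_prod {d : ℕ → ℕ} (hd : ∀ n, 0 < d n) (R : ℕ)
    (φ : Matrix (Fin R) (Fin R) ℂ →⋆ₐ[ℂ] UHF d) :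
    ∃ M, R ∣ ∏ n ∈ Finset.range M, d n := by
  rcases Nat.eq_zero_or_pos R with rfl | hR
  · -- `M_0` is the zero ring, and a unital embedding of it would give `1 = 0`.
    exfalso
    have h0 : (1 : Matrix (Fin 0) (Fin 0) ℂ) = 0 := Subsingleton.elim _ _
    have h1 : (1 : UHF d) = 0 := by rw [← map_one φ, h0, map_zero]
    have h2 := approxTrace_one hd 0
    rw [show (1 : TensorSpace d →L[ℂ] TensorSpace d) = 0 from congrArg Subtype.val h1,
      map_zero] at h2
    exact zero_ne_one h2
  have : NeZero R := ⟨hR.ne'⟩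
  let u : Fin R → Fin R → TensorSpace d →L[ℂ] TensorSpace d := fun i j =>
    (φ (Matrix.single i j 1)).1
  have hmem : ∀ i j, u i j ∈ uhfSubalgebra d := fun i j => (φ (Matrix.single i j 1)).2
  have hmul : ∀ i j k, u i j * u j k = u i k := fun i j k => by
    have := congrArg Subtype.val (map_mul φ (Matrix.single i j (1 : ℂ)) (Matrix.single j k 1))
    rw [Matrix.single_mul_single_same, one_mul] at this
    exact this.symm
  have hstar : ∀ i j, star (u i j) = u j i := fun i j => by
    have := congrArg Subtype.val (map_star φ (Matrix.single i j (1 : ℂ)))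
    rw [Matrix.star_eq_conjTranspose, Matrix.conjTranspose_single, star_one] at this
    exact this.symm
  have hsum : ∑ i, u i i = 1 := by
    have h1 : ∑ i : Fin R, Matrix.single i i (1 : ℂ) = 1 := by
      ext a b
      simp [Matrix.sum_apply, Matrix.single_apply, Matrix.one_apply, ite_and]
    have h2 := congrArg Subtype.val (congrArg φ h1)
    rw [map_sum, map_one] at h2
    simpa using h2
  set p := u 0 0 with hp
  have hproj : IsStarProjection p := ⟨hmul 0 0 0, hstar 0 0⟩
  -- `R` times the asymptotic trace of `p` is `1`.
  have hpR : Tendsto (fun N => (R : ℂ) * approxTrace hd N p) atTop (𝓝 1) := by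
    have h1 : Tendsto (fun N => ∑ i : Fin R, approxTrace hd N (u i 0 * u 0 i - u 0 i * u i 0))
        atTop (𝓝 0) := by
      simpa using tendsto_finsetSum Finset.univ fun i _ =>
        tendsto_approxTrace_commutator hd (hmem i 0) (hmem 0 i)
    have h2 := h1.const_sub 1
    rw [sub_zero] at h2
    refine h2.congr fun N => ?_
    simp only [hmul, map_sub, Finset.sum_sub_distrib, Finset.sum_const, Finset.card_univ,
      Fintype.card_fin, nsmul_eq_mul]
    rw [← map_sum, hsum, approxTrace_one, sub_sub_cancel]
  -- Approximate `p` by a self-adjoint operator on finitely many factors.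
  obtain ⟨a, ha, hap⟩ := Metric.mem_closure_iff.1 (hmem 0 0) (1 / 32) (by norm_num)
  rw [dist_eq_norm, ← norm_neg, neg_sub] at hap
  set b := (1 / 2 : ℂ) • (a + star a) with hb
  have hb_mem : b ∈ StarAlgebra.adjoin ℂ (matrixUnits d) :=
    StarSubalgebra.smul_mem _ (add_mem ha (star_mem ha)) _
  have hb_sa : IsSelfAdjoint b := by
    rw [IsSelfAdjoint, hb, star_smul, star_add, star_star, add_comm]
    simp
  have hb_near : ‖b - p‖ < 1 / 32 := by
    have h1 : b - p = (1 / 2 : ℂ) • ((a - p) + star (a - p)) := by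
      rw [star_sub, hproj.isSelfAdjoint.star_eq, hb, sub_add_sub_comm, smul_sub, ← two_smul ℂ p,
        smul_smul]
      norm_num
    rw [h1, norm_smul]
    have h2 := norm_add_le (a - p) (star (a - p))
    have h5 : ‖star (a - p)‖ = ‖a - p‖ := norm_star (E := TensorSpace d →L[ℂ] TensorSpace d) (a - p)
    have h3 : ‖(1 / 2 : ℂ)‖ = 1 / 2 := by norm_num
    rw [h3]
    have h4 : ‖a - p‖ < 1 / 32 := hap
    linarith
  obtain ⟨M, hM⟩ := exists_mem_localAlgebra hb_mem
  have hUclosed : IsClosed (uhfSubalgebra d : Set (TensorSpace d →L[ℂ] TensorSpace d)) :=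
    StarSubalgebra.isClosed_topologicalClosure _
  obtain ⟨e, ⟨heU, heM⟩, heproj, hep⟩ := exists_isStarProjection_mem
    (uhfSubalgebra d ⊓ localAlgebra d M) (hUclosed.inter (isClosed_localAlgebra M)) hproj hb_sa
    ⟨adjoin_le_uhfSubalgebra hb_mem, hM⟩ hb_near
  obtain ⟨x, hx, y, hy, hpxy, heyx⟩ := exists_eq_mul_of_norm_sub_lt (uhfSubalgebra d) hUclosed
    hproj heproj (hmem 0 0) heU hep
  -- The trace of `e` is a fraction with denominator `∏ n ∈ Finset.range M, d n`.
  obtain ⟨m, hm⟩ := exists_natCast_eq_trace (e := compression hd M e) (by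
    rw [IsIdempotentElem, ← compression_mul hd e heM, heproj.isIdempotentElem.eq])
  have hlim : Tendsto (fun N => (R : ℂ) * approxTrace hd N p) atTop
      (𝓝 (R * approxTrace hd M e)) := by
    refine Tendsto.const_mul _ ?_
    have h1 := (tendsto_approxTrace_commutator hd hx hy).add_const (approxTrace hd M e)
    rw [zero_add] at h1
    refine h1.congr' ?_
    filter_upwards [eventually_ge_atTop M] with N hN
    rw [map_sub, ← hpxy, ← heyx, approxTrace_of_le hd hN heM, sub_add_cancel]
  have heq := tendsto_nhds_unique hlim hpR
  rw [approxTrace_apply, hm, ← mul_div_assoc, div_eq_one_iff_eq (prod_range_ne_zero hd M)] at heq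
  exact ⟨M, m, by exact_mod_cast heq.symm⟩

end Trace

end RandomUHF

/-! ### The algebras attached to paths of the chain -/

namespace RandomUHF

open MeasureTheory Filter Topology

section Label

variable (e : ℕ ≃ Nat.Primes)

theorem label_natCast_add_one (n : ℕ) : label e ((n : ℤ) + 1) = e n := rfl

theorem label_of_nonpos {x : ℤ} (hx : x ≤ 0) : label e x = 1 := by
  rcases hx.lt_or_eq with h | rfl
  · obtain ⟨m, rfl⟩ := Int.eq_negSucc_of_lt_zero h
    rfl
  · rfl

theorem exists_eq_natCast_add_one {x : ℤ} (hx : 0 < x) : ∃ n : ℕ, x = (n : ℤ) + 1 :=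
  ⟨x.toNat - 1, by lia⟩

theorem label_prime {x : ℤ} (hx : 0 < x) : (label e x).Prime := by
  obtain ⟨n, rfl⟩ := exists_eq_natCast_add_one hx
  exact (e n).2

theorem label_pos (x : ℤ) : 0 < label e x := by
  rcases le_or_gt x 0 with h | h
  · rw [label_of_nonpos e h]; exact one_pos
  · exact (label_prime e h).pos

theorem label_ne_one_iff {x : ℤ} : label e x ≠ 1 ↔ 0 < x := by
  refine ⟨fun h => ?_, fun h => (label_prime e h).ne_one⟩
  by_contra! hx
  exact h (label_of_nonpos e hx)

theorem label_inj {x y : ℤ} (hx : 0 < x) (hy : 0 < y) (h : label e x = label e y) : x = y := by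
  obtain ⟨n, rfl⟩ := exists_eq_natCast_add_one hx
  obtain ⟨m, rfl⟩ := exists_eq_natCast_add_one hy
  have := e.injective (Subtype.ext h : e n = e m)
  rw [this]

theorem finite_label_ne_one_iff (y : ℕ → ℤ) :
    {n | label e (y n) ≠ 1}.Finite ↔ ∀ᶠ n in atTop, y n ≤ 0 := by
  rw [← Nat.cofinite_eq_atTop, eventually_cofinite]
  simp only [label_ne_one_iff, not_le]

/-- Both admissible conditions on the prime factors say that the chain stays below `k`. -/
theorem forall_prime_dvd_label_iff {k : ℕ} {C : ℕ → Prop}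
    (hC : (C = fun r => ∃ j : ℕ, 1 ≤ j ∧ j ≤ k ∧ r = label e j) ∨
      (StrictMono (fun n => (e n : ℕ)) ∧ C = fun r => r ≤ label e k)) (x : ℤ) :
    (∀ r : ℕ, r.Prime → r ∣ label e x → C r) ↔ x ≤ k := by
  rcases le_or_gt x 0 with hx | hx
  · rw [label_of_nonpos e hx]
    exact ⟨fun _ => by lia, fun _ r hr h1 => absurd (Nat.dvd_one.1 h1) hr.ne_one⟩
  have hiff : (∀ r : ℕ, r.Prime → r ∣ label e x → C r) ↔ C (label e x) := by
    refine ⟨fun h => h _ (label_prime e hx) dvd_rfl, fun h r hr hrx => ?_⟩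
    rwa [(Nat.prime_dvd_prime_iff_eq hr (label_prime e hx)).1 hrx]
  rw [hiff]
  rcases hC with rfl | ⟨hmono, rfl⟩
  · beta_reduce
    constructor
    · rintro ⟨j, hj1, hjk, hj⟩
      rw [label_inj e hx (by lia) hj]
      exact_mod_cast hjk
    · intro hxk
      exact ⟨x.toNat, by lia, by lia, by rw [Int.toNat_of_nonneg hx.le]⟩
  · obtain ⟨n, rfl⟩ := exists_eq_natCast_add_one hx
    beta_reduce
    cases k with
    | zero =>
      rw [label_of_nonpos e (show ((0 : ℕ) : ℤ) ≤ 0 by simp)]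
      exact ⟨fun h => absurd h (not_le.2 (e n).2.one_lt), fun h => by lia⟩
    | succ k =>
      have h : label e ((n : ℤ) + 1) ≤ label e ((k : ℤ) + 1) ↔ n ≤ k := hmono.le_iff_le
      rw [Nat.cast_succ]
      exact h.trans (by lia)

theorem finiteDimensional_label_iff (y : ℕ → ℤ) :
    FiniteDimensional ℂ (UHF fun n => label e (y n)) ↔ ∀ᶠ n in atTop, y n ≤ 0 := by
  rw [finiteDimensional_iff fun n => label_pos e (y n), finite_label_ne_one_iff]

theorem isMatrixAlgebraWith_label_iff {k : ℕ} {C : ℕ → Prop}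
    (hC : (C = fun r => ∃ j : ℕ, 1 ≤ j ∧ j ≤ k ∧ r = label e j) ∨
      (StrictMono (fun n => (e n : ℕ)) ∧ C = fun r => r ≤ label e k)) (y : ℕ → ℤ) :
    IsMatrixAlgebraWith C (UHF fun n => label e (y n)) ↔
      (∀ᶠ n in atTop, y n ≤ 0) ∧ ∀ n, y n ≤ k := by
  rw [isMatrixAlgebraWith_iff fun n => label_pos e (y n), finite_label_ne_one_iff]
  exact and_congr_right fun _ => forall_congr' fun n => forall_prime_dvd_label_iff e hC (y n)

/-- If every state is visited infinitely often, every prime occurs infinitely often as a factor.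
The same holds for the prime factors of the numbers `1, 2, 3, …`, so the tensor factors can be
distributed over blocks such that the `m`-th block consists of the prime factors of `m + 1`. -/
theorem nonempty_equiv_universalUHF (y : ℕ → ℤ) (hy : ∀ j : ℕ, ∃ᶠ n in atTop, y n = j) :
    Nonempty ((UHF fun n => label e (y n)) ≃⋆ₐ[ℂ] UniversalUHF) := by
  -- `B` enumerates the prime factors of the numbers `m + 1` with multiplicity, and `κ` matches them
  -- with the times at which the corresponding primes occur.
  let B := Σ m : ℕ, Fin (m + 1).primeFactorsList.length
  let idx : B → ℕ := fun t =>
    e.symm ⟨(t.1 + 1).primeFactorsList[t.2], Nat.prime_of_mem_primeFactorsList (List.getElem_mem _)⟩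
  have hidx : ∀ t : B, (e (idx t) : ℕ) = (t.1 + 1).primeFactorsList[t.2] := fun t =>
    congrArg Subtype.val (e.apply_symm_apply _)
  have hinf : ∀ j, Infinite {t : B // idx t = j} := by
    intro j
    have hmem : ∀ a : ℕ, ∃ t : B, idx t = j ∧ t.1 + 1 = (e j : ℕ) * (a + 1) := by
      intro a
      have hpos : 0 < (e j : ℕ) * (a + 1) := Nat.mul_pos (e j).2.pos a.succ_pos
      obtain ⟨m, hm⟩ : ∃ m, m + 1 = (e j : ℕ) * (a + 1) := ⟨_, Nat.sub_add_cancel hpos⟩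
      have h1 : (e j : ℕ) ∈ (m + 1).primeFactorsList :=
        (Nat.mem_primeFactorsList m.succ_ne_zero).2 ⟨(e j).2, a + 1, hm⟩
      obtain ⟨k, hk, hkj⟩ := List.getElem_of_mem h1
      refine ⟨⟨m, ⟨k, hk⟩⟩, e.injective (Subtype.ext ?_), hm⟩
      rw [hidx]
      exact hkj
    choose t ht1 ht2 using hmem
    refine Infinite.of_injective (fun a => (⟨t a, ht1 a⟩ : {t : B // idx t = j})) ?_
    intro a b hab
    have h1 : t a = t b := congrArg Subtype.val hab
    have h2 := ht2 a
    rw [h1, ht2 b] at h2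
    have := Nat.eq_of_mul_eq_mul_left (e j).2.pos h2
    lia
  have hinf' : ∀ j : ℕ, Infinite {n : ℕ // y n = (j : ℤ) + 1} := fun j =>
    Set.infinite_coe_iff.2 (Nat.frequently_atTop_iff_infinite.1 (by exact_mod_cast hy (j + 1)))
  have hequiv : ∀ j : ℕ, Nonempty ({t : B // idx t = j} ≃ {n : ℕ // y n = (j : ℤ) + 1}) :=
    fun j => nonempty_equiv_of_countable
  let f : ∀ j : ℕ, {t : B // idx t = j} ≃ {n : ℕ // y n = (j : ℤ) + 1} :=
    fun j => (hequiv j).some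
  let κ : B → ℕ := fun t => f (idx t) ⟨t, rfl⟩
  have hκ : ∀ j t (h : idx t = j), κ t = f j ⟨t, h⟩ := by
    rintro _ t rfl; rfl
  have hyκ : ∀ t, y (κ t) = (idx t : ℤ) + 1 := fun t => (f (idx t) ⟨t, rfl⟩).2
  have hκinj : Function.Injective κ := by
    intro s t hst
    have h1 := hyκ s
    rw [hst, hyκ t] at h1
    have h2 : idx t = idx s := by lia
    rw [hκ (idx s) s rfl, hκ (idx s) t h2] at hst
    exact congrArg Subtype.val ((f (idx s)).injective (Subtype.ext hst))
  refine nonempty_uhf_equiv_of_blocks (fun n => label_pos e (y n))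
    (fun m => Finset.univ.map ⟨fun k : Fin (m + 1).primeFactorsList.length => κ ⟨m, k⟩,
      fun k l hkl => eq_of_heq (Sigma.mk.inj (hκinj hkl)).2⟩) ?_ ?_ ?_
  · intro k m hkm
    refine Finset.disjoint_left.2 fun n h1 h2 => hkm ?_
    obtain ⟨a, -, ha⟩ := Finset.mem_map.1 h1
    obtain ⟨b, -, hb⟩ := Finset.mem_map.1 h2
    exact congrArg Sigma.fst (hκinj (ha.trans hb.symm))
  · intro n hn
    obtain ⟨j, hj⟩ := exists_eq_natCast_add_one ((label_ne_one_iff e).1 hn)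
    obtain ⟨⟨t, ht⟩, hft⟩ := (f j).surjective ⟨n, hj⟩
    refine ⟨t.1, Finset.mem_map.2 ⟨t.2, Finset.mem_univ _, ?_⟩⟩
    change κ t = n
    rw [hκ j t ht, hft]
  · intro m
    have h : ∀ k, label e (y (κ ⟨m, k⟩)) = (m + 1).primeFactorsList[k] := fun k => by
      rw [hyκ]
      exact hidx ⟨m, k⟩
    rw [Finset.prod_map]
    refine (Finset.prod_congr rfl fun k _ => h k).trans ?_
    exact (Fin.prod_univ_getElem _).trans (Nat.prod_primeFactorsList m.succ_ne_zero)

/-- If every state is visited finitely often, the algebra is of finite type: the multiplicity of a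
prime is at most the number of visits to the corresponding state. -/
theorem isFiniteType_label (y : ℕ → ℤ) (hy : ∀ j : ℕ, ∀ᶠ n in atTop, y n ≠ j) :
    IsFiniteType (UHF fun n => label e (y n)) := by
  intro r
  obtain ⟨j, rfl⟩ := e.surjective r
  have hfin : {n | y n = (j : ℤ) + 1}.Finite := by
    have h := hy (j + 1)
    rw [← Nat.cofinite_eq_atTop, eventually_cofinite] at h
    simpa using h
  refine lt_of_le_of_lt (iSup_le fun k => ?_) (ENat.natCast_lt_top hfin.toFinset.card)
  obtain ⟨k, ⟨φ⟩⟩ := k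
  obtain ⟨M, hM⟩ := exists_dvd_prod (fun n => label_pos e (y n)) _ φ
  have hne : ∀ n ∈ Finset.range M, label e (y n) ≠ 0 := fun n _ => (label_pos e (y n)).ne'
  have h1 := ((e j).2.pow_dvd_iff_le_factorization (Finset.prod_ne_zero_iff.2 hne)).1 hM
  rw [Nat.factorization_prod hne, Finsupp.finsetSum_apply] at h1
  have h2 : ∀ n, (label e (y n)).factorization (e j) ≤ if n ∈ hfin.toFinset then 1 else 0 := by
    intro n
    have hmem : n ∈ hfin.toFinset ↔ y n = (j : ℤ) + 1 := by
      rw [Set.Finite.mem_toFinset, Set.mem_ofPred_eq]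
    simp only [hmem]
    rcases le_or_gt (y n) 0 with hn | hn
    · simp [label_of_nonpos e hn]
    · rw [(label_prime e hn).factorization, Finsupp.single_apply]
      refine le_of_eq (if_congr ?_ rfl rfl)
      rw [← label_natCast_add_one]
      exact ⟨fun h => label_inj e hn (by lia) h, fun h => by rw [h]⟩
  have h3 := h1.trans (Finset.sum_le_sum fun n _ => h2 n)
  rw [← Finset.sum_filter, Finset.sum_const, smul_eq_mul, mul_one] at h3
  have h4 : ((Finset.range M).filter fun n => n ∈ hfin.toFinset).card ≤ hfin.toFinset.card :=
    Finset.card_le_card fun n hn => (Finset.mem_filter.1 hn).2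
  exact_mod_cast h3.trans h4

end Label

end RandomUHF

/-! ### The random UHF algebra -/

namespace RandomUHF

open MeasureTheory Filter Topology

variable {Ω : Type*} [MeasurableSpace Ω] {P : Measure Ω} {ν : ℤ → ℝ} {p q : ℕ → ℝ}
  {Y : ℕ → Ω → ℤ}

theorem IsMarkovChain.measurableSet_eventually_nonpos
    (hY : IsMarkovChain P ν (transition p q) Y) :
    MeasurableSet {ω | ∀ᶠ n in atTop, Y n ω ≤ 0} := by
  simp only [eventually_atTop, Set.ofPred_exists, Set.ofPred_forall]
  exact MeasurableSet.iUnion fun N => MeasurableSet.iInter fun n => MeasurableSet.iInter fun _ =>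
    hY.measurable n measurableSet_Iic

theorem IsMarkovChain.measurableSet_forall_le (hY : IsMarkovChain P ν (transition p q) Y)
    (k : ℤ) : MeasurableSet {ω | ∀ n, Y n ω ≤ k} := by
  simp only [Set.ofPred_forall]
  exact MeasurableSet.iInter fun n => hY.measurable n measurableSet_Iic

variable [IsProbabilityMeasure P]

/-- The algebra is finite dimensional if and only if the chain is absorbed, up to null sets. -/
theorem measureReal_finiteDimensional (e : ℕ ≃ Nat.Primes)
    (hY : IsMarkovChain P ν (transition p q) Y) :
    P.real {ω | FiniteDimensional ℂ (RandomAlgebra e Y ω)} = P.real {ω | ∃ n, Y n ω < 0} := by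
  simp only [finiteDimensional_label_iff]
  refine measureReal_congr ?_
  filter_upwards [ae_absorbed_iff hY] with ω hω
  exact propext hω.symm

theorem measureReal_isMatrixAlgebraWith (e : ℕ ≃ Nat.Primes) {k : ℕ} {C : ℕ → Prop}
    (hC : (C = fun r => ∃ j : ℕ, 1 ≤ j ∧ j ≤ k ∧ r = label e j) ∨
      (StrictMono (fun n => (e n : ℕ)) ∧ C = fun r => r ≤ label e k))
    (hY : IsMarkovChain P ν (transition p q) Y) :
    P.real {ω | IsMatrixAlgebraWith C (RandomAlgebra e Y ω)} =
      P.real {ω | (∃ n, Y n ω < 0) ∧ ∀ n, Y n ω ≤ k} := by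
  simp only [isMatrixAlgebraWith_label_iff e hC]
  refine measureReal_congr ?_
  filter_upwards [ae_absorbed_iff hY] with ω hω
  exact propext (and_congr_left' hω.symm)

end RandomUHF

theorem theorem3p1
    (e : ℕ ≃ Nat.Primes)
    (p q π : ℕ → ℝ)
    (hp : ∀ i, 0 < p i) (hq₀ : 0 ≤ q 0) (hq : ∀ i, 1 ≤ i → 0 < q i) (hpq : ∀ i, p i + q i = 1)
    (hπ₀ : ∀ i, 0 ≤ π i) (hπ : HasSum π 1)
    {Ω : Type*} [MeasurableSpace Ω] (P : MeasureTheory.Measure Ω)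
    [MeasureTheory.IsProbabilityMeasure P]
    (Y : ℕ → Ω → ℤ)
    (hY : RandomUHF.IsMarkovChain P (RandomUHF.initialDist π) (RandomUHF.transition p q) Y) :
    -- the reflecting case
    (q 0 = 0 →
      ((¬ Summable (fun n : ℕ => ∏ i ∈ Finset.Icc 1 (n + 1), q i / p i) ∨
          (∃ p' q' : ℝ, p' ≤ q' ∧ ∀ i, 1 ≤ i → p i = p' ∧ q i = q')) →
        ∀ᵐ ω ∂P, Nonempty (RandomUHF.RandomAlgebra e Y ω ≃⋆ₐ[ℂ] RandomUHF.UniversalUHF)) ∧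
      ((Summable (fun n : ℕ => ∏ i ∈ Finset.Icc 1 (n + 1), q i / p i) ∨
          (∃ p' q' : ℝ, q' < p' ∧ ∀ i, 1 ≤ i → p i = p' ∧ q i = q')) →
        ∀ᵐ ω ∂P, RandomUHF.IsFiniteType (RandomUHF.RandomAlgebra e Y ω))) ∧
    -- the absorbing case
    (0 < q 0 →
      -- finite dimensionality
      (MeasurableSet {ω | FiniteDimensional ℂ (RandomUHF.RandomAlgebra e Y ω)} ∧
        ((¬ Summable (RandomUHF.cSeq p q) ∨
            (∃ p' q' : ℝ, p' ≤ q' ∧ ∀ i, 1 ≤ i → p i = p' ∧ q i = q')) →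
          P.real {ω | FiniteDimensional ℂ (RandomUHF.RandomAlgebra e Y ω)} = 1) ∧
        (Summable (RandomUHF.cSeq p q) →
          Summable (fun i : ℕ => π i * ∑' n : ℕ, RandomUHF.cSeq p q (i + n)) ∧
          P.real {ω | FiniteDimensional ℂ (RandomUHF.RandomAlgebra e Y ω)} =
            (∑' i : ℕ, π i * ∑' n : ℕ, RandomUHF.cSeq p q (i + n)) /
              (1 + ∑' n : ℕ, RandomUHF.cSeq p q n)) ∧
        (∀ p' q' : ℝ, q' < p' → (∀ i, p i = p' ∧ q i = q') →
          Summable (fun i : ℕ => π i * (q' / p') ^ (i + 1)) ∧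
          P.real {ω | FiniteDimensional ℂ (RandomUHF.RandomAlgebra e Y ω)} =
            ∑' i : ℕ, π i * (q' / p') ^ (i + 1))) ∧
      -- matrix algebras `M_N`: the prime factors of `N` do not go beyond `m_k`, either in the
      -- order of the enumeration or, if the enumeration is increasing, in the usual order
      (∀ (k : ℕ) (C : ℕ → Prop),
        ((C = fun r => ∃ j : ℕ, 1 ≤ j ∧ j ≤ k ∧ r = RandomUHF.label e j) ∨
          (StrictMono (fun n => (e n : ℕ)) ∧ C = fun r => r ≤ RandomUHF.label e k)) →
        MeasurableSet {ω | RandomUHF.IsMatrixAlgebraWith C (RandomUHF.RandomAlgebra e Y ω)} ∧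
        P.real {ω | RandomUHF.IsMatrixAlgebraWith C (RandomUHF.RandomAlgebra e Y ω)} =
          (∑ i ∈ Finset.range (k + 1), π i * ∑ n ∈ Finset.Icc i k, RandomUHF.cSeq p q n) /
            (1 + ∑ n ∈ Finset.range (k + 1), RandomUHF.cSeq p q n) ∧
        (∀ p' q' : ℝ, p' = q' → (∀ i, p i = p' ∧ q i = q') →
          P.real {ω | RandomUHF.IsMatrixAlgebraWith C (RandomUHF.RandomAlgebra e Y ω)} =
            ∑ i ∈ Finset.range (k + 1), π i * (((k : ℝ) + 1 - i) / ((k : ℝ) + 2))))) := by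
  refine ⟨fun hq0 => ⟨fun h => ?_, fun h => ?_⟩, fun hq0 => ?_⟩
  · have hs := h.elim id fun ⟨p', q', hle, hc⟩ =>
      RandomUHF.not_summable_reflecting_of_le hp hle hc
    filter_upwards [RandomUHF.ae_frequently_eq hp hq0 hq hpq hY hY.ae_initial_nonneg hs] with ω hω
    exact RandomUHF.nonempty_equiv_universalUHF e _ hω
  · have hs := h.elim id fun ⟨p', q', hlt, hc⟩ =>
      RandomUHF.summable_reflecting_of_lt hp hq hlt hc
    filter_upwards [RandomUHF.ae_eventually_ne_of_summable hpq hY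
      (RandomUHF.reflectingWeight_pos hp hq) (RandomUHF.reflectingWeight_subharmonic hp hq0)
      (RandomUHF.summable_reflectingWeight.2 hs)] with ω hω
    exact RandomUHF.isFiniteType_label e _ hω
  have hq' : ∀ i, 0 < q i := fun i => i.eq_zero_or_pos.elim (fun h => h ▸ hq0) (hq i)
  refine ⟨⟨?_, fun h => ?_, fun hs => ?_, fun p' q' hlt hc => ?_⟩, fun k C hC =>
    ⟨?_, ?_, fun p' q' hpq' hc => ?_⟩⟩
  · simpa only [RandomUHF.finiteDimensional_label_iff] using hY.measurableSet_eventually_nonpos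
  · have hs := h.elim id fun ⟨p', q', hle, hc⟩ =>
      RandomUHF.not_summable_cSeq_of_le hp hq' hle hc
    rw [RandomUHF.measureReal_finiteDimensional e hY, MeasureTheory.measureReal_congr
      (Filter.eventuallyEq_univ.2 (RandomUHF.ae_absorbed_of_not_summable hp hq' hpq hY hs)),
      MeasureTheory.probReal_univ]
  · have hpos : 0 < 1 + ∑' n : ℕ, RandomUHF.cSeq p q n :=
      add_pos_of_pos_of_nonneg one_pos (tsum_nonneg fun n =>
        (RandomUHF.absorbingWeight_pos hp hq' (n + 1)).le)
    have h := (RandomUHF.hasSum_absorbed hp hq' hpq hY hs).mul_right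
      (1 + ∑' n : ℕ, RandomUHF.cSeq p q n)
    simp only [← mul_div_assoc, div_mul_cancel₀ _ hpos.ne'] at h
    exact ⟨h.summable, by rw [h.tsum_eq, mul_div_cancel_right₀ _ hpos.ne',
      RandomUHF.measureReal_finiteDimensional e hY]⟩
  · have hp' : 0 < p' := (hc 0).1 ▸ hp 0
    have hr0 : 0 ≤ q' / p' := div_nonneg ((hc 0).2 ▸ hq0.le) hp'.le
    have hr1 : q' / p' < 1 := (div_lt_one hp').2 hlt
    have hgeom := hasSum_geometric_of_lt_one hr0 hr1
    have hc' : RandomUHF.cSeq p q = fun n => (q' / p') ^ (n + 1) :=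
      funext (RandomUHF.cSeq_of_const hc)
    have htail : ∀ i, HasSum (fun n => (q' / p') ^ (i + n + 1))
        ((q' / p') ^ (i + 1) * (1 - q' / p')⁻¹) := fun i => by
      simpa only [← pow_add, add_right_comm i] using hgeom.mul_left ((q' / p') ^ (i + 1))
    have hs : Summable (RandomUHF.cSeq p q) := by
      rw [hc']
      simpa using (htail 0).summable
    have h := RandomUHF.hasSum_absorbed hp hq' hpq hY hs
    have hone : 1 + ∑' n : ℕ, (q' / p') ^ (n + 1) = (1 - q' / p')⁻¹ := by
      rw [← hgeom.tsum_eq, hgeom.summable.tsum_eq_zero_add, pow_zero]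
    have hne : (1 - q' / p')⁻¹ ≠ 0 := inv_ne_zero (sub_pos.2 hr1).ne'
    simp only [hc', (htail _).tsum_eq, hone, mul_div_cancel_right₀ _ hne] at h
    rw [RandomUHF.measureReal_finiteDimensional e hY]
    exact ⟨h.summable, h.tsum_eq.symm⟩
  · simp only [RandomUHF.isMatrixAlgebraWith_label_iff e hC]
    exact hY.measurableSet_eventually_nonpos.inter (hY.measurableSet_forall_le k)
  · rw [RandomUHF.measureReal_isMatrixAlgebraWith e hC hY,
      RandomUHF.measureReal_ruin_eq hp hq' hpq hY k]
  · rw [RandomUHF.measureReal_isMatrixAlgebraWith e hC hY,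
      RandomUHF.measureReal_ruin_eq hp hq' hpq hY k, Finset.sum_div]
    have hc1 : ∀ n, RandomUHF.cSeq p q n = 1 := fun n => by
      rw [RandomUHF.cSeq_of_const hc, ← hpq', div_self ((hc 0).1 ▸ (hp 0).ne'), one_pow]
    refine Finset.sum_congr rfl fun i hi => ?_
    have hik : i ≤ k + 1 := (Finset.mem_range.1 hi).le
    simp only [hc1, Finset.sum_const, Nat.card_Icc, Finset.card_range, nsmul_eq_mul, mul_one,
      Nat.cast_sub hik]
    push_cast
    ring
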